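/- Rings are associative with unit. Let $k$ be a commutative artinian ring, let $A$ and $B$ be artin $k$-algebras (that is, $k$-algebras that are finitely generated as $k$-modules), and let $\lambda:A\to B$ be an injective homomorphism of $k$-algebras that is an epimorphism in the category of rings. View $B$ as an $A$-$A$-bimodule via $\lambda$, and suppose that the right $A$-module $B_A$ has projective dimension at most $1$ and that $\mathrm{Tor}_1^A(B,B)=0$. Let $C=\mathrm{End}_A(B/\lambda(A))$ be the endomorphism ring of the right $A$-module $B/\lambda(A)$, and let $\mu:A\to C$ be the ring homomorphism given by the left $A$-module structure of $B/\lambda(A)$, that is, $\mu(a)(b+\lambda(A))=\lambda(a)b+\lambda(A)$. Then $\mu$ is a homological epimorphism, i.e. an epimorphism in the category of rings with $\mathrm{Tor}_i^A(C,C)=0$ for all $i\ge 1$, and $C$, viewed as a left $A$-module via $\mu$, has projective dimension at most $1$. If, moreover, the left $A$-module $\mathrm{Ext}^1_A(B_A,A_A)$ (with the left action induced by left multiplication on the second argument $A$) has projective dimension at most $1$, then $\mu$ has a stratifying kernel: there is an idempotent $e\in A$ with $\ker\mu=AeA$, and the quotient map $A\to A/\ker\mu$ is a homological epimorphism. -/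

import Mathlib

universe u

open CategoryTheory MulOpposite
open scoped TensorProduct

/-!
Rings are associative and unital, not necessarily commutative. Right `A`-modules are modules over
the opposite ring `Aᵐᵒᵖ`, where `op a • m` stands for `m a`.
-/

noncomputable section

namespace RingEpi

section Tensor

variable (A : Type u) [Ring A]

/-- The subgroup of `M ⊗[ℤ] N` generated by the elements `m a ⊗ n - m ⊗ a n`. -/
def balancedRel (M N : Type u) [AddCommGroup M] [Module Aᵐᵒᵖ M] [AddCommGroup N] [Module A N] :
    AddSubgroup (M ⊗[ℤ] N) :=
  AddSubgroup.closure {x | ∃ (m : M) (a : A) (n : N), x = (op a • m) ⊗ₜ[ℤ] n - m ⊗ₜ[ℤ] (a • n)}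

/-- The tensor product over `A` of a right `A`-module and a left `A`-module. -/
abbrev Tensor (M N : Type u) [AddCommGroup M] [Module Aᵐᵒᵖ M] [AddCommGroup N] [Module A N] :
    Type u :=
  (M ⊗[ℤ] N) ⧸ balancedRel A M N

variable {A}

/-- The elementary tensor `m ⊗ n`. -/
def tmul {M N : Type u} [AddCommGroup M] [Module Aᵐᵒᵖ M] [AddCommGroup N] [Module A N]
    (m : M) (n : N) : Tensor A M N :=
  QuotientAddGroup.mk (m ⊗ₜ[ℤ] n)

theorem tensor_hom_ext {M N : Type u} [AddCommGroup M] [Module Aᵐᵒᵖ M] [AddCommGroup N]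
    [Module A N] {P : Type u} [AddCommGroup P] {g h : Tensor A M N →+ P}
    (H : ∀ m n, g (tmul m n) = h (tmul m n)) : g = h := by
  ext x
  induction x using TensorProduct.induction_on with
  | zero => exact (map_zero g).trans (map_zero h).symm
  | tmul m n => exact H m n
  | add x y hx hy =>
    simp only [AddMonoidHom.comp_apply, map_add] at hx hy ⊢
    rw [hx, hy]

/-- The map `g ⊗ N : M ⊗ N → M' ⊗ N` induced by a map `g : M → M'` of right `A`-modules. -/
def tensorMap {M M' : Type u} [AddCommGroup M] [Module Aᵐᵒᵖ M] [AddCommGroup M'] [Module Aᵐᵒᵖ M']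
    (N : Type u) [AddCommGroup N] [Module A N] (g : M →ₗ[Aᵐᵒᵖ] M') :
    Tensor A M N →+ Tensor A M' N :=
  QuotientAddGroup.map (balancedRel A M N) (balancedRel A M' N)
    (LinearMap.rTensor N g.toAddMonoidHom.toIntLinearMap).toAddMonoidHom (by
      refine (AddSubgroup.closure_le _).2 ?_
      rintro _ ⟨m, a, n, rfl⟩
      refine AddSubgroup.subset_closure ⟨g m, a, n, ?_⟩
      rw [map_sub]
      exact congrArg (fun z => z ⊗ₜ[ℤ] n - g m ⊗ₜ[ℤ] (a • n)) (map_smul g (op a) m))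

/-- The functor `- ⊗ N` from right `A`-modules to abelian groups. -/
def tensorFunctor (N : ModuleCat.{u} A) : ModuleCat.{u} Aᵐᵒᵖ ⥤ AddCommGrpCat.{u} where
  obj M := AddCommGrpCat.of (Tensor A M N)
  map g := AddCommGrpCat.ofHom (tensorMap N g.hom)
  map_id _ := AddCommGrpCat.hom_ext (tensor_hom_ext fun _ _ => rfl)
  map_comp _ _ := AddCommGrpCat.hom_ext (tensor_hom_ext fun _ _ => rfl)

instance (N : ModuleCat.{u} A) : (tensorFunctor N).Additive where
  map_add {_ _ g h} := AddCommGrpCat.hom_ext <| tensor_hom_ext fun m n =>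
    congrArg QuotientAddGroup.mk (TensorProduct.add_tmul (g.hom m) (h.hom m) n)

/-- `Tor_i^A(M, N)`, the value at `M` of the `i`-th left derived functor of `- ⊗ N`. -/
def Tor (i : ℕ) (M : ModuleCat.{u} Aᵐᵒᵖ) (N : ModuleCat.{u} A) : AddCommGrpCat.{u} :=
  ((tensorFunctor N).leftDerived i).obj M

end Tensor

section Epi

variable {A B : Type u} [Ring A] [Ring B]

/-- `B` as a right `A`-module along a ring homomorphism `f : A → B`. -/
abbrev rightModule (f : A →+* B) : ModuleCat.{u} Aᵐᵒᵖ :=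
  (ModuleCat.restrictScalars (RingHom.op f)).obj (ModuleCat.of Bᵐᵒᵖ B)

/-- `B` as a left `A`-module along a ring homomorphism `f : A → B`. -/
abbrev leftModule (f : A →+* B) : ModuleCat.{u} A :=
  (ModuleCat.restrictScalars f).obj (ModuleCat.of B B)

/-- An epimorphism in the category of rings. -/
def IsRingEpi (f : A →+* B) : Prop :=
  Epi (RingCat.ofHom f)

/-- A ring epimorphism `A → B` with `Tor_i^A(B, B) = 0` for all `i ≥ 1`. -/
def IsHomologicalEpi (f : A →+* B) : Prop :=
  IsRingEpi f ∧ ∀ i : ℕ, 1 ≤ i → Limits.IsZero (Tor i (rightModule f) (leftModule f))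

/-- A two-sided ideal `I` of the form `A e A` with `e` idempotent, for which `A → A / I` is a
homological epimorphism. -/
def IsStratifyingIdeal (I : Ideal A) [I.IsTwoSided] : Prop :=
  (∃ e : A, IsIdempotentElem e ∧ I = Ideal.span {x | ∃ a b : A, x = a * e * b}) ∧
    IsHomologicalEpi (Ideal.Quotient.mk I)

end Epi

section EndCoker

variable {A B : Type u} [Ring A] [Ring B] (f : A →+* B)

/-- The image of `f : A → B` as a right `A`-submodule of `B`. -/
def imageRight : Submodule Aᵐᵒᵖ (rightModule f) where
  carrier := {b | ∃ a : A, f a = b}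
  add_mem' := by
    rintro _ _ ⟨a, rfl⟩ ⟨a', rfl⟩
    exact ⟨a + a', map_add f a a'⟩
  zero_mem' := ⟨0, map_zero f⟩
  smul_mem' := by
    rintro c _ ⟨a, rfl⟩
    exact ⟨a * unop c, map_mul f a (unop c)⟩

/-- The right `A`-module `B / f(A)`. -/
abbrev Coker : Type u := rightModule f ⧸ imageRight f

/-- The endomorphism ring of the right `A`-module `B / f(A)`. -/
abbrev EndCoker : Type u := Module.End Aᵐᵒᵖ (Coker f)

/-- Left multiplication by `f a` on `B`, as an endomorphism of the right `A`-module `B`. -/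
def mulLeftRight (a : A) : Module.End Aᵐᵒᵖ (rightModule f) where
  toFun b := (f a * (show B from b) : B)
  map_add' b b' := mul_add (f a) (show B from b) (show B from b')
  map_smul' c b := (mul_assoc (f a) (show B from b) (f (unop c))).symm

/-- The ring homomorphism `μ : A → End_A(B / f(A))` given by the left `A`-module structure of
`B / f(A)`. -/
def mu : A →+* EndCoker f where
  toFun a := (imageRight f).mapQ (imageRight f) (mulLeftRight f a) (by
    rintro _ ⟨a', rfl⟩
    exact ⟨a * a', map_mul f a a'⟩)
  map_one' := Submodule.linearMap_qext _ <| LinearMap.ext fun b =>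
    congrArg (imageRight f).mkQ (show f 1 * (show B from b) = b by rw [map_one, one_mul])
  map_mul' a a' := Submodule.linearMap_qext _ <| LinearMap.ext fun b =>
    congrArg (imageRight f).mkQ
      (show f (a * a') * (show B from b) = f a * (f a' * (show B from b)) by
        rw [map_mul, mul_assoc])
  map_zero' := Submodule.linearMap_qext _ <| LinearMap.ext fun b =>
    congrArg (imageRight f).mkQ (show f 0 * (show B from b) = 0 by rw [map_zero, zero_mul])
  map_add' a a' := Submodule.linearMap_qext _ <| LinearMap.ext fun b =>
    congrArg (imageRight f).mkQ
      (show f (a + a') * (show B from b) = f a * (show B from b) + f a' * (show B from b) by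
        rw [map_add, add_mul])

end EndCoker

section ExtModule

variable {A : Type u} [Ring A]

/-- Left multiplication by `a` as an endomorphism of the right `A`-module `A`. -/
def regularMulLeft (a : A) : ModuleCat.of Aᵐᵒᵖ A ⟶ ModuleCat.of Aᵐᵒᵖ A :=
  ModuleCat.ofHom
    { toFun := fun x => a * x
      map_add' := mul_add a
      map_smul' := fun c x => (mul_assoc a x (unop c)).symm }

/-- The left `A`-module structure of `Ext^n_A(X, A)`, for a right `A`-module `X`, that is induced
by the left multiplications on the second argument `A`. -/
abbrev extModule (X : ModuleCat.{u} Aᵐᵒᵖ) (n : ℕ) :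
    Module A (Abelian.Ext.{u} X (ModuleCat.of Aᵐᵒᵖ A) n) where
  smul a x := x.comp (Abelian.Ext.mk₀ (regularMulLeft a)) (add_zero n)
  one_smul x := by
    have h : regularMulLeft (1 : A) = 𝟙 _ := ModuleCat.hom_ext (LinearMap.ext fun y => one_mul y)
    change x.comp (Abelian.Ext.mk₀ (regularMulLeft 1)) (add_zero n) = x
    rw [h, Abelian.Ext.comp_mk₀_id]
  mul_smul a b x := by
    have h : regularMulLeft (a * b) = regularMulLeft b ≫ regularMulLeft a :=
      ModuleCat.hom_ext (LinearMap.ext fun y => mul_assoc a b y)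
    change x.comp (Abelian.Ext.mk₀ (regularMulLeft (a * b))) (add_zero n) =
      (x.comp (Abelian.Ext.mk₀ (regularMulLeft b)) (add_zero n)).comp
        (Abelian.Ext.mk₀ (regularMulLeft a)) (add_zero n)
    rw [h, ← Abelian.Ext.mk₀_comp_mk₀, Abelian.Ext.comp_assoc_of_third_deg_zero]
  smul_zero a := Abelian.Ext.zero_comp _ _ _ _ (add_zero n)
  smul_add a x y := Abelian.Ext.add_comp _ _ _ _
  add_smul a b x := by
    have h : regularMulLeft (a + b) = regularMulLeft a + regularMulLeft b :=
      ModuleCat.hom_ext (LinearMap.ext fun y => add_mul a b y)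
    change x.comp (Abelian.Ext.mk₀ (regularMulLeft (a + b))) (add_zero n) =
      x.comp (Abelian.Ext.mk₀ (regularMulLeft a)) (add_zero n) +
        x.comp (Abelian.Ext.mk₀ (regularMulLeft b)) (add_zero n)
    rw [h, Abelian.Ext.mk₀_add, Abelian.Ext.comp_add]
  zero_smul x := by
    have h : regularMulLeft (0 : A) = 0 := ModuleCat.hom_ext (LinearMap.ext fun y => zero_mul y)
    change x.comp (Abelian.Ext.mk₀ (regularMulLeft 0)) (add_zero n) = 0
    rw [h, Abelian.Ext.mk₀_zero, Abelian.Ext.comp_zero]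

/-- The left `A`-module `Ext^n_A(X, A)` for a right `A`-module `X`. -/
def extLeft (X : ModuleCat.{u} Aᵐᵒᵖ) (n : ℕ) : ModuleCat.{u} A :=
  letI := extModule X n
  ModuleCat.of A (Abelian.Ext.{u} X (ModuleCat.of Aᵐᵒᵖ A) n)

end ExtModule

end RingEpi

end

/-!
Let `p : F → B` be a surjection from a finitely generated free right `A`-module and let `K` be the
pullback of `f : A → B` and `p`. It is the kernel of the presentation `A × F → B`, hence projective
when `B` has projective dimension at most one, and also the kernel of `F → B / f(A)`.

Since `B / f(A) ⊗ B = 0` and `Tor₁(B, B) = 0`, the map `K ⊗ B → F ⊗ B` is bijective, so by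
adjunction every map `K → B` extends uniquely to `F`. Applying `Hom_A(K, -)` to `A → B → B / f(A)`,
the connecting map therefore yields a projective resolution `0 → F* → K* → C → 0` of the left
`A`-module `C = End_A(B / f(A))`. Tensoring it with `C` turns `F* → K*` into
`Hom_A(F, C) → Hom_A(K, C)`, whose kernel `Hom_A(B / f(A), C)` is by adjunction a group of maps out
of `B / f(A) ⊗ B = 0`. So `Tor_i(C, C) = 0` for `i ≥ 1`. If `φ` in `K*` lies over `c` in `C`, then
`1 ⊗ φ` and `c ⊗ π`, with `π : K → A` the projection, which lies over `1`, differ by an element of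
`C ⊗ F*`; hence `c ⊗ 1 = 1 ⊗ c` and `μ` is an epimorphism.

Evaluation at `1` identifies `B* = Hom_A(B, A)` with `ker μ`. The sequence
`0 → B* → (A × F)* → K* → Ext¹(B, A) → 0` is exact, so when `Ext¹(B, A)` has projective dimension at
most one, `B*` is a direct summand of `(A × F)*` and is generated by a dual basis. Then `ker μ` is
projective and idempotent. Over a semiprimary ring an idempotent ideal `I` has the form `A e A`, and
`M ⊗ I = 0` for every `A / I`-module `M`, so `0 → I → A → A / I → 0` shows that the quotient map is
homological when `I` is projective.
-/

noncomputable section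

namespace RingEpi

section ExactSequences

variable {R X Y Z W : Type*} [Ring R] [AddCommGroup X] [Module R X] [AddCommGroup Y] [Module R Y]
  [AddCommGroup Z] [Module R Z] [AddCommGroup W] [Module R W] {d : X →ₗ[R] Y} {e : Y →ₗ[R] Z}

theorem exact_range_subtype (h : Function.Exact d e) :
    Function.Exact (LinearMap.range d).subtype e :=
  LinearMap.exact_iff.2 ((LinearMap.exact_iff.1 h).trans (Submodule.range_subtype _).symm)

theorem exact_rangeRestrict (h : Function.Exact d e) : Function.Exact d e.rangeRestrict :=
  LinearMap.exact_iff.2 ((LinearMap.ker_rangeRestrict e).trans (LinearMap.exact_iff.1 h))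

theorem exists_lift_of_exact (hd : Function.Injective d) (h : Function.Exact d e)
    {g : W →ₗ[R] Y} (hg : e ∘ₗ g = 0) : ∃ g' : W →ₗ[R] X, d ∘ₗ g' = g :=
  have hrange (w : W) : g w ∈ LinearMap.range d := (h _).1 (LinearMap.congr_fun hg w)
  let i := LinearEquiv.ofInjective d hd
  ⟨i.symm.toLinearMap ∘ₗ g.codRestrict _ hrange,
    LinearMap.ext fun w => congrArg Subtype.val (i.apply_symm_apply ⟨g w, hrange w⟩)⟩

theorem exists_descend_of_exact (h : Function.Exact d e) (he : Function.Surjective e)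
    {g : Y →ₗ[R] W} (hg : g ∘ₗ d = 0) : ∃ g' : Z →ₗ[R] W, g' ∘ₗ e = g :=
  ⟨(LinearMap.range d).liftQ g (LinearMap.range_le_ker_iff.2 hg) ∘ₗ
      (h.linearEquivOfSurjective he).symm.toLinearMap, LinearMap.ext fun y => by
    have hy : (h.linearEquivOfSurjective he).symm (e y) = (LinearMap.range d).mkQ y :=
      (LinearEquiv.symm_apply_eq _).2 rfl
    simp [hy]⟩

end ExactSequences

section TensorProduct

variable {A : Type u} [Ring A]

section Elementary

variable {M N : Type u} [AddCommGroup M] [Module Aᵐᵒᵖ M] [AddCommGroup N] [Module A N]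

theorem tmul_add (m : M) (n n' : N) : tmul (A := A) m (n + n') = tmul m n + tmul m n' :=
  congrArg QuotientAddGroup.mk (TensorProduct.tmul_add m n n')

theorem add_tmul (m m' : M) (n : N) : tmul (A := A) (m + m') n = tmul m n + tmul m' n :=
  congrArg QuotientAddGroup.mk (TensorProduct.add_tmul m m' n)

theorem smul_tmul (m : M) (a : A) (n : N) : tmul (A := A) (op a • m) n = tmul m (a • n) :=
  sub_eq_zero.1 <|
    (QuotientAddGroup.eq_zero_iff _).2 (AddSubgroup.subset_closure ⟨m, a, n, rfl⟩)

theorem tensor_induction {p : Tensor A M N → Prop} (zero : p 0)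
    (tmul : ∀ m n, p (tmul m n)) (add : ∀ x y, p x → p y → p (x + y)) (z : Tensor A M N) :
    p z := by
  obtain ⟨x, rfl⟩ := QuotientAddGroup.mk_surjective z
  induction x using TensorProduct.induction_on with
  | zero => exact zero
  | tmul m n => exact tmul m n
  | add x y hx hy => exact add _ _ hx hy

/-- The universal biadditive balanced map `(m, n) ↦ m ⊗ n`, in curried form. -/
def tmulHom (M N : Type u) [AddCommGroup M] [Module Aᵐᵒᵖ M] [AddCommGroup N] [Module A N] :
    M →+ N →+ Tensor A M N :=
  AddMonoidHom.mk' (fun m => AddMonoidHom.mk' (fun n => tmul m n) (tmul_add m))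
    fun m m' => AddMonoidHom.ext fun n => add_tmul m m' n

@[simp]
theorem tmulHom_apply (m : M) (n : N) : tmulHom (A := A) M N m n = tmul m n := rfl

theorem zero_tmul (n : N) : tmul (A := A) (0 : M) n = 0 :=
  map_zero ((tmulHom M N).flip n)

theorem tmul_zero (m : M) : tmul (A := A) m (0 : N) = 0 :=
  map_zero (tmulHom M N m)

/-- The map out of the tensor product that corresponds to a biadditive balanced map. -/
def tensorLift {P : Type*} [AddCommGroup P] (φ : M →+ N →+ P)
    (h : ∀ m (a : A) n, φ (op a • m) n = φ m (a • n)) : Tensor A M N →+ P :=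
  QuotientAddGroup.lift (balancedRel A M N)
    (TensorProduct.liftAddHom φ fun r m n => by simp) (by
      refine (AddSubgroup.closure_le _).2 ?_
      rintro _ ⟨m, a, n, rfl⟩
      simp [h])

end Elementary

section Functoriality

variable {M M' N N' : Type u} [AddCommGroup M] [Module Aᵐᵒᵖ M] [AddCommGroup M'] [Module Aᵐᵒᵖ M']
  [AddCommGroup N] [Module A N] [AddCommGroup N'] [Module A N']

@[simp]
theorem tensorMap_tmul (g : M →ₗ[Aᵐᵒᵖ] M') (m : M) (n : N) :
    tensorMap N g (tmul m n) = tmul (g m) n := rfl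

/-- The map `M ⊗ h : M ⊗ N → M ⊗ N'` induced by a map `h : N → N'` of left `A`-modules. -/
def tensorMapRight (M : Type u) [AddCommGroup M] [Module Aᵐᵒᵖ M] (h : N →ₗ[A] N') :
    Tensor A M N →+ Tensor A M N' :=
  tensorLift ((tmulHom M N').compl₂ h.toAddMonoidHom) fun m a n => by
    simp [smul_tmul]

@[simp]
theorem tensorMapRight_tmul (h : N →ₗ[A] N') (m : M) (n : N) :
    tensorMapRight M h (tmul m n) = tmul m (h n) := rfl

theorem tensorMap_id : tensorMap N (LinearMap.id : M →ₗ[Aᵐᵒᵖ] M) = AddMonoidHom.id _ :=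
  tensor_hom_ext fun _ _ => rfl

theorem tensorMap_comp {M'' : Type u} [AddCommGroup M''] [Module Aᵐᵒᵖ M'']
    (g : M →ₗ[Aᵐᵒᵖ] M') (g' : M' →ₗ[Aᵐᵒᵖ] M'') :
    tensorMap N (g' ∘ₗ g) = (tensorMap N g').comp (tensorMap N g) :=
  tensor_hom_ext fun _ _ => rfl

theorem tensorMap_add (g g' : M →ₗ[Aᵐᵒᵖ] M') :
    tensorMap N (g + g') = tensorMap N g + tensorMap N g' :=
  tensor_hom_ext fun m n => add_tmul (g m) (g' m) n

theorem tensorMapRight_tensorMap (g : M →ₗ[Aᵐᵒᵖ] M') (h : N →ₗ[A] N') (z : Tensor A M N) :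
    tensorMapRight M' h (tensorMap N g z) = tensorMap N' g (tensorMapRight M h z) :=
  DFunLike.congr_fun (tensor_hom_ext (g := (tensorMapRight M' h).comp (tensorMap N g))
    (h := (tensorMap N' g).comp (tensorMapRight M h)) fun _ _ => rfl) z

end Functoriality

section Exactness

variable {M M' M'' N N' N'' : Type u} [AddCommGroup M] [Module Aᵐᵒᵖ M]
  [AddCommGroup M'] [Module Aᵐᵒᵖ M'] [AddCommGroup M''] [Module Aᵐᵒᵖ M'']
  [AddCommGroup N] [Module A N] [AddCommGroup N'] [Module A N'] [AddCommGroup N''] [Module A N'']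

theorem tensorMap_surjective {g : M →ₗ[Aᵐᵒᵖ] M'} (hg : Function.Surjective g) :
    Function.Surjective (tensorMap N g) := by
  refine AddMonoidHom.range_eq_top.1 ((AddSubgroup.eq_top_iff' _).2 fun z => ?_)
  induction z using tensor_induction with
  | zero => exact zero_mem _
  | tmul m n =>
    obtain ⟨m, rfl⟩ := hg m
    exact ⟨tmul m n, rfl⟩
  | add x y hx hy => exact add_mem hx hy

theorem tensorMapRight_surjective {h : N →ₗ[A] N'} (hh : Function.Surjective h) :
    Function.Surjective (tensorMapRight M h) := by
  refine AddMonoidHom.range_eq_top.1 ((AddSubgroup.eq_top_iff' _).2 fun z => ?_)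
  induction z using tensor_induction with
  | zero => exact zero_mem _
  | tmul m n =>
    obtain ⟨n, rfl⟩ := hh n
    exact ⟨tmul m n, rfl⟩
  | add x y hx hy => exact add_mem hx hy

theorem tensorMap_exact {κ : M →ₗ[Aᵐᵒᵖ] M'} {q : M' →ₗ[Aᵐᵒᵖ] M''} (hκq : Function.Exact κ q)
    (hq : Function.Surjective q) : Function.Exact (tensorMap N κ) (tensorMap N q) := by
  let mk := QuotientAddGroup.mk' (tensorMap N κ).range
  let φ : M'' →+ N →+ _ := q.toAddMonoidHom.liftOfSurjective hq
    ⟨(tmulHom M' N).compr₂ mk, fun m hm => by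
      obtain ⟨x, rfl⟩ := (hκq m).1 hm
      exact AddMonoidHom.ext fun n => (QuotientAddGroup.eq_zero_iff _).2
        (AddMonoidHom.mem_range.2 ⟨tmul x n, rfl⟩)⟩
  have hφ (m n) : φ (q m) n = mk (tmul m n) :=
    DFunLike.congr_fun (AddMonoidHom.liftOfRightInverse_comp_apply _ _ _ _ m) n
  let ψ : Tensor A M'' N →+ _ := tensorLift φ fun m a n => by
    obtain ⟨m, rfl⟩ := hq m
    rw [← map_smul, hφ, hφ, smul_tmul]
  refine fun z => ⟨fun hz => AddMonoidHom.mem_range.1 ((QuotientAddGroup.eq_zero_iff z).1 ?_), ?_⟩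
  · have hψ : ψ.comp (tensorMap N q) = mk := tensor_hom_ext hφ
    exact (DFunLike.congr_fun hψ z).symm.trans ((congrArg ψ hz).trans (map_zero ψ))
  · rintro ⟨x, rfl⟩
    exact DFunLike.congr_fun (tensor_hom_ext (g := (tensorMap N q).comp (tensorMap N κ)) (h := 0)
      fun m n => by simp [hκq.apply_apply_eq_zero, zero_tmul]) x

theorem tensorMapRight_exact {κ : N →ₗ[A] N'} {q : N' →ₗ[A] N''} (hκq : Function.Exact κ q)
    (hq : Function.Surjective q) : Function.Exact (tensorMapRight M κ) (tensorMapRight M q) := by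
  let mk := QuotientAddGroup.mk' (tensorMapRight M κ).range
  let φ : N'' →+ M →+ _ := q.toAddMonoidHom.liftOfSurjective hq
    ⟨(tmulHom M N').flip.compr₂ mk, fun n hn => by
      obtain ⟨x, rfl⟩ := (hκq n).1 hn
      exact AddMonoidHom.ext fun m => (QuotientAddGroup.eq_zero_iff _).2
        (AddMonoidHom.mem_range.2 ⟨tmul m x, rfl⟩)⟩
  have hφ (m n) : φ (q n) m = mk (tmul m n) :=
    DFunLike.congr_fun (AddMonoidHom.liftOfRightInverse_comp_apply _ _ _ _ n) m
  let ψ : Tensor A M N'' →+ _ := tensorLift φ.flip fun m a n => by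
    obtain ⟨n, rfl⟩ := hq n
    simp only [AddMonoidHom.flip_apply]
    rw [← map_smul, hφ, hφ, smul_tmul]
  refine fun z => ⟨fun hz => AddMonoidHom.mem_range.1 ((QuotientAddGroup.eq_zero_iff z).1 ?_), ?_⟩
  · have hψ : ψ.comp (tensorMapRight M q) = mk := tensor_hom_ext hφ
    exact (DFunLike.congr_fun hψ z).symm.trans ((congrArg ψ hz).trans (map_zero ψ))
  · rintro ⟨x, rfl⟩
    exact DFunLike.congr_fun (tensor_hom_ext
      (g := (tensorMapRight M q).comp (tensorMapRight M κ)) (h := 0)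
      fun m n => by simp [hκq.apply_apply_eq_zero, tmul_zero]) x

theorem tensorMapRight_injective_of_projective [Module.Projective Aᵐᵒᵖ M] {h : N →ₗ[A] N'}
    (hh : Function.Injective h) : Function.Injective (tensorMapRight M h) := by
  obtain ⟨s, hs⟩ := Module.projective_def.1 (inferInstance : Module.Projective Aᵐᵒᵖ M)
  let coord (X : Type u) [AddCommGroup X] [Module A X] : Tensor A M X →+ (M →₀ X) :=
    tensorLift (AddMonoidHom.mk' (fun m => AddMonoidHom.mk'
      (fun n => (s m).mapRange (fun a => unop a • n) (zero_smul A n))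
      fun n n' => Finsupp.ext fun i => smul_add _ n n')
      fun m m' => AddMonoidHom.ext fun n => Finsupp.ext fun i => by simp [add_smul])
      fun m a n => Finsupp.ext fun i => by simp [mul_smul]
  let glue : (M →₀ N) →+ Tensor A M N := Finsupp.liftAddHom (tmulHom M N)
  have glue_coord : glue.comp (coord N) = AddMonoidHom.id _ := tensor_hom_ext fun m n => by
    calc glue ((s m).mapRange (fun a => unop a • n) (zero_smul A n))
        = (s m).sum fun i a => tmul i (unop a • n) :=
          Finsupp.sum_mapRange_index fun i => tmul_zero i
      _ = (tmulHom M N).flip n ((s m).sum fun i a => a • i) := by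
          simp [map_finsuppSum, ← smul_tmul]
      _ = tmul m n := congrArg (tmul · n) (hs m)
  have coord_map : (coord N').comp (tensorMapRight M h) =
      (Finsupp.mapRange.addMonoidHom h.toAddMonoidHom).comp (coord N) :=
    tensor_hom_ext fun m n => Finsupp.ext fun i => (map_smul h _ n).symm
  have hcoord : Function.Injective (coord N' ∘ tensorMapRight M h) := by
    rw [← AddMonoidHom.coe_comp, coord_map]
    exact (Finsupp.mapRange_injective h (map_zero h) hh).comp
      (Function.LeftInverse.injective (g := glue) (DFunLike.congr_fun glue_coord))
  exact hcoord.of_comp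

theorem tensorMap_injective_of_projective [Module.Projective A N] {g : M →ₗ[Aᵐᵒᵖ] M'}
    (hg : Function.Injective g) : Function.Injective (tensorMap N g) := by
  obtain ⟨s, hs⟩ := Module.projective_def.1 (inferInstance : Module.Projective A N)
  let coord (X : Type u) [AddCommGroup X] [Module Aᵐᵒᵖ X] : Tensor A X N →+ (N →₀ X) :=
    tensorLift (AddMonoidHom.mk' (fun m => AddMonoidHom.mk'
      (fun n => (s n).mapRange (fun a => op a • m) (zero_smul Aᵐᵒᵖ m))
      fun n n' => Finsupp.ext fun i => by simp [add_smul])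
      fun m m' => AddMonoidHom.ext fun n => Finsupp.ext fun i => smul_add _ m m')
      fun m a n => Finsupp.ext fun i => by simp [mul_smul]
  let glue : (N →₀ M) →+ Tensor A M N := Finsupp.liftAddHom (tmulHom M N).flip
  have glue_coord : glue.comp (coord M) = AddMonoidHom.id _ := tensor_hom_ext fun m n => by
    calc glue ((s n).mapRange (fun a => op a • m) (zero_smul Aᵐᵒᵖ m))
        = (s n).sum fun i a => tmul (op a • m) i :=
          Finsupp.sum_mapRange_index fun i => zero_tmul i
      _ = tmulHom M N m ((s n).sum fun i a => a • i) := by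
          simp [map_finsuppSum, smul_tmul]
      _ = tmul m n := congrArg (tmul m) (hs n)
  have coord_map : (coord M').comp (tensorMap N g) =
      (Finsupp.mapRange.addMonoidHom g.toAddMonoidHom).comp (coord M) :=
    tensor_hom_ext fun m n => Finsupp.ext fun i => (map_smul g _ m).symm
  have hcoord : Function.Injective (coord M' ∘ tensorMap N g) := by
    rw [← AddMonoidHom.coe_comp, coord_map]
    exact (Finsupp.mapRange_injective g (map_zero g) hg).comp
      (Function.LeftInverse.injective (g := glue) (DFunLike.congr_fun glue_coord))
  exact hcoord.of_comp

end Exactness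

end TensorProduct

section Tor

variable {A : Type u} [Ring A] {K F M K' F' N N₀ N₁ : Type u}
  [AddCommGroup K] [Module Aᵐᵒᵖ K] [AddCommGroup F] [Module Aᵐᵒᵖ F] [AddCommGroup M] [Module Aᵐᵒᵖ M]
  [AddCommGroup K'] [Module Aᵐᵒᵖ K'] [AddCommGroup F'] [Module Aᵐᵒᵖ F']
  [AddCommGroup N] [Module A N] [AddCommGroup N₀] [Module A N₀] [AddCommGroup N₁] [Module A N₁]

theorem exact_tensorMap_iff_injective {d : K →ₗ[Aᵐᵒᵖ] F} {e : F →ₗ[Aᵐᵒᵖ] M}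
    (h : Function.Exact d e) : Function.Exact (tensorMap N d) (tensorMap N e) ↔
      Function.Injective (tensorMap N (LinearMap.range e).subtype) := by
  have hsurj := tensorMap_surjective (N := N) e.surjective_rangeRestrict
  have hex := tensorMap_exact (N := N) (exact_rangeRestrict h) e.surjective_rangeRestrict
  have hcomp (z : Tensor A F N) : tensorMap N (LinearMap.range e).subtype
      (tensorMap N e.rangeRestrict z) = tensorMap N e z :=
    (DFunLike.congr_fun (tensorMap_comp _ _) z).symm
  constructor
  · intro H
    refine (injective_iff_map_eq_zero _).2 fun z hz => ?_
    obtain ⟨z, rfl⟩ := hsurj z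
    exact (hex z).2 ((H z).1 ((hcomp z).symm.trans hz))
  · intro H z
    rw [← hex z, ← hcomp]
    exact map_eq_zero_iff _ H

theorem isZero_tor_succ_iff {M : ModuleCat.{u} Aᵐᵒᵖ} (P : ProjectiveResolution M)
    (N : ModuleCat.{u} A) (n : ℕ) : Limits.IsZero (Tor (n + 1) M N) ↔
      Function.Injective
        (tensorMap N (LinearMap.range (P.complex.d (n + 1) n).hom).subtype) := by
  rw [← exact_tensorMap_iff_injective (d := (P.complex.d (n + 2) (n + 1)).hom)]
  · rw [Tor, (P.isoLeftDerivedObj (tensorFunctor N) (n + 1)).isZero_iff,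
      HomologicalComplex.homologyFunctor_obj, ← HomologicalComplex.exactAt_iff_isZero_homology,
      HomologicalComplex.exactAt_iff' _ (n + 2) (n + 1) n (by simp only [ChainComplex.prev]; rfl)
        (by simp), ShortComplex.ab_exact_iff_function_exact]
    rfl
  · exact (ShortComplex.ShortExact.moduleCat_exact_iff_function_exact _).1 (P.exact_succ n)

-- `Tor₁` is balanced: the snake lemma for the two presentations, with `- ⊗ N₀` exact.
theorem tensorMap_injective_of_tensorMapRight_injective [Module.Projective A N₀]
    {κ : K →ₗ[Aᵐᵒᵖ] F} {q : F →ₗ[Aᵐᵒᵖ] M} (hκ : Function.Injective κ)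
    (hκq : Function.Exact κ q) (hq : Function.Surjective q)
    {i : N₁ →ₗ[A] N₀} {p : N₀ →ₗ[A] N} (hip : Function.Exact i p) (hp : Function.Surjective p)
    (h : Function.Injective (tensorMapRight M i)) : Function.Injective (tensorMap N κ) := by
  refine (injective_iff_map_eq_zero _).2 fun z hz => ?_
  obtain ⟨z, rfl⟩ := tensorMapRight_surjective hp z
  rw [← tensorMapRight_tensorMap] at hz
  obtain ⟨y, hy⟩ := (tensorMapRight_exact hip hp _).1 hz
  have hy0 : tensorMap N₁ q y = 0 := h (by
    rw [map_zero, tensorMapRight_tensorMap, hy]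
    exact (tensorMap_exact hκq hq _).2 ⟨z, rfl⟩)
  obtain ⟨x, rfl⟩ := (tensorMap_exact hκq hq _).1 hy0
  rw [tensorMapRight_tensorMap] at hy
  exact (tensorMapRight_exact hip hp _).2 ⟨x, tensorMap_injective_of_projective hκ hy⟩

theorem isZero_tor_of_projective_resolution [Module.Projective A N₁] [Module.Projective A N₀]
    (M : ModuleCat.{u} Aᵐᵒᵖ) (N : ModuleCat.{u} A) {i : N₁ →ₗ[A] N₀} {p : N₀ →ₗ[A] N}
    (hi : Function.Injective i) (hip : Function.Exact i p) (hp : Function.Surjective p)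
    (h : Function.Injective (tensorMapRight M i)) {n : ℕ} (hn : 1 ≤ n) :
    Limits.IsZero (Tor n M N) := by
  obtain ⟨n, rfl⟩ := Nat.exists_eq_add_of_le' hn
  let P := ProjectiveResolution.of M
  rw [isZero_tor_succ_iff P]
  cases n with
  | zero =>
    have hex := (ShortComplex.ShortExact.moduleCat_exact_iff_function_exact _).1 P.exact₀
    exact tensorMap_injective_of_tensorMapRight_injective (Submodule.subtype_injective _)
      (exact_range_subtype hex) ((ModuleCat.epi_iff_surjective (P.π.f 0)).1 inferInstance) hip hp h
  | succ n =>
    have hex := (ShortComplex.ShortExact.moduleCat_exact_iff_function_exact _).1 (P.exact_succ n)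
    let e := (P.complex.d (n + 1) n).hom
    refine tensorMap_injective_of_tensorMapRight_injective (q := e.rangeRestrict)
      (Submodule.subtype_injective _) (exact_rangeRestrict (exact_range_subtype hex))
      (LinearMap.surjective_rangeRestrict _) hip hp ?_
    have hproj : Module.Projective Aᵐᵒᵖ (P.complex.X n) :=
      (IsProjective.iff_projective _).2 (P.projective n)
    have hcomp : Function.Injective
        (tensorMapRight (P.complex.X n) i ∘ tensorMap N₁ (LinearMap.range e).subtype) :=
      (tensorMapRight_injective_of_projective hi).comp
        (tensorMap_injective_of_projective (Submodule.subtype_injective _))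
    have hswap : tensorMapRight (P.complex.X n) i ∘ tensorMap N₁ (LinearMap.range e).subtype =
        tensorMap N₀ (LinearMap.range e).subtype ∘ tensorMapRight (LinearMap.range e) i :=
      funext fun z => tensorMapRight_tensorMap _ _ z
    exact (hswap ▸ hcomp).of_comp

-- Schanuel's lemma: two projective presentations of `M` are chain homotopy equivalent.
theorem tensorMap_injective_of_presentation [Module.Projective Aᵐᵒᵖ F]
    [Module.Projective Aᵐᵒᵖ F'] {κ : K →ₗ[Aᵐᵒᵖ] F} {q : F →ₗ[Aᵐᵒᵖ] M} {κ' : K' →ₗ[Aᵐᵒᵖ] F'}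
    {q' : F' →ₗ[Aᵐᵒᵖ] M} (hκ : Function.Injective κ) (hκq : Function.Exact κ q)
    (hq : Function.Surjective q) (hκ' : Function.Injective κ') (hκq' : Function.Exact κ' q')
    (hq' : Function.Surjective q') (h : Function.Injective (tensorMap N κ')) :
    Function.Injective (tensorMap N κ) := by
  obtain ⟨α, hα⟩ := Module.projective_lifting_property q' q hq'
  obtain ⟨β, hβ⟩ := Module.projective_lifting_property q q' hq
  obtain ⟨α', hα'⟩ := exists_lift_of_exact hκ' hκq' (g := α ∘ₗ κ) (by
    rw [← LinearMap.comp_assoc, hα, hκq.linearMap_comp_eq_zero])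
  obtain ⟨β', hβ'⟩ := exists_lift_of_exact hκ hκq (g := β ∘ₗ κ') (by
    rw [← LinearMap.comp_assoc, hβ, hκq'.linearMap_comp_eq_zero])
  obtain ⟨γ, hγ⟩ := exists_lift_of_exact hκ hκq (g := β ∘ₗ α - LinearMap.id) (by
    rw [LinearMap.comp_sub, ← LinearMap.comp_assoc, hβ, hα, LinearMap.comp_id, sub_self])
  have hhomotopy : β' ∘ₗ α' = LinearMap.id + γ ∘ₗ κ := by
    refine (LinearMap.cancel_left hκ).1 ?_
    rw [← LinearMap.comp_assoc, hβ', LinearMap.comp_assoc, hα', LinearMap.comp_add,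
      ← LinearMap.comp_assoc, ← LinearMap.comp_assoc, hγ, LinearMap.sub_comp,
      LinearMap.comp_id, LinearMap.id_comp, add_sub_cancel]
  refine (injective_iff_map_eq_zero _).2 fun z hz => ?_
  have hα'z : tensorMap N α' z = 0 := h <| by
    rw [map_zero, ← AddMonoidHom.comp_apply, ← tensorMap_comp, hα', tensorMap_comp,
      AddMonoidHom.comp_apply, hz, map_zero]
  have hz' := congrArg (fun g => tensorMap N g z) hhomotopy
  simpa [tensorMap_comp, tensorMap_add, tensorMap_id, hα'z, hz] using hz'.symm

theorem tensorMap_injective_of_isZero_tor_one [Module.Projective Aᵐᵒᵖ F]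
    (M : ModuleCat.{u} Aᵐᵒᵖ) (N : ModuleCat.{u} A) (h : Limits.IsZero (Tor 1 M N))
    {κ : K →ₗ[Aᵐᵒᵖ] F} {q : F →ₗ[Aᵐᵒᵖ] M} (hκ : Function.Injective κ)
    (hκq : Function.Exact κ q) (hq : Function.Surjective q) :
    Function.Injective (tensorMap N κ) := by
  let P := ProjectiveResolution.of M
  have hproj : Module.Projective Aᵐᵒᵖ (P.complex.X 0) :=
    (IsProjective.iff_projective _).2 (P.projective 0)
  have hex := (ShortComplex.ShortExact.moduleCat_exact_iff_function_exact _).1 P.exact₀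
  exact tensorMap_injective_of_presentation hκ hκq hq (Submodule.subtype_injective _)
    (exact_range_subtype hex) ((ModuleCat.epi_iff_surjective (P.π.f 0)).1 inferInstance)
    ((isZero_tor_succ_iff P N 0).1 h)

end Tor

section RingEpimorphism

variable {A B : Type u} [Ring A] [Ring B] {f : A →+* B}

-- The action of `B` on `Y × Y'` and its conjugate by the shear `(y, y') ↦ (y, y' + φ y)` agree on
-- `A`, hence on `B`.
theorem IsRingEpi.map_smul (hf : IsRingEpi f) {Y Y' : Type u} [AddCommGroup Y] [Module B Y]
    [AddCommGroup Y'] [Module B Y'] (φ : Y →+ Y') (hφ : ∀ a y, φ (f a • y) = f a • φ y)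
    (b : B) (y : Y) : φ (b • y) = b • φ y := by
  let action : B →+* Module.End ℤ (Y × Y') := Module.toModuleEnd ℤ (Y × Y')
  let shear : (Y × Y') ≃ₗ[ℤ] (Y × Y') :=
    (LinearEquiv.refl ℤ Y).skewProd (LinearEquiv.refl ℤ Y') φ.toIntLinearMap
  have hshear (z : Y × Y') : shear z = (z.1, z.2 + φ z.1) := rfl
  have hconj (b : B) (z : Y × Y') : shear.conjRingEquiv (action b) (shear z) = shear (b • z) :=
    congrArg (fun w => shear (b • w)) (shear.symm_apply_apply z)
  have hA : RingCat.ofHom f ≫ RingCat.ofHom action =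
      RingCat.ofHom f ≫ RingCat.ofHom (shear.conjRingEquiv.toRingHom.comp action) := by
    refine RingCat.hom_ext (RingHom.ext fun a => LinearMap.ext fun z => ?_)
    obtain ⟨z, rfl⟩ := shear.surjective z
    refine Eq.trans ?_ (hconj (f a) z).symm
    change f a • shear z = shear (f a • z)
    simp [hshear, hφ]
  have hB : action = shear.conjRingEquiv.toRingHom.comp action := by
    have hE : Epi (RingCat.ofHom f) := hf
    exact congrArg RingCat.Hom.hom ((cancel_epi _).1 hA)
  have h : b • shear (y, 0) = shear (b • (y, 0)) :=
    (DFunLike.congr_fun (RingHom.congr_fun hB b) (shear (y, 0))).trans (hconj b (y, 0))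
  simpa [hshear] using (congrArg Prod.snd h).symm

/-- Left multiplication on `B`, as a ring homomorphism to the endomorphisms of the right
`A`-module `B`. -/
def mulLeftEnd (f : A →+* B) : B →+* Module.End Aᵐᵒᵖ (rightModule f) where
  toFun b :=
    { toFun := fun x : B => (b * x : B)
      map_add' := fun x y : B => mul_add b x y
      map_smul' := fun c x => (mul_assoc b (show B from x) (f (unop c))).symm }
  map_one' := LinearMap.ext fun x : B => one_mul x
  map_mul' b c := LinearMap.ext fun x : B => mul_assoc b c x
  map_zero' := LinearMap.ext fun x : B => zero_mul x
  map_add' b c := LinearMap.ext fun x : B => add_mul b c x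

/-- The action of the endomorphisms of `M` on `M ⊗ N`. -/
def tensorMapEnd (M N : Type u) [AddCommGroup M] [Module Aᵐᵒᵖ M] [AddCommGroup N] [Module A N] :
    Module.End Aᵐᵒᵖ M →+* AddMonoid.End (Tensor A M N) where
  toFun g := tensorMap N g
  map_one' := tensorMap_id
  map_mul' g g' := tensorMap_comp g' g
  map_zero' := tensor_hom_ext fun _ n => zero_tmul n
  map_add' g g' := tensorMap_add g g'

/-- The element `x ⊗ y` of `B ⊗ B`, for `x` and `y` in `B`. -/
abbrev btmul (f : A →+* B) (x y : B) : Tensor A (rightModule f) (leftModule f) :=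
  tmul (M := rightModule f) (N := leftModule f) x y

/-- The map out of `B ⊗ B` that corresponds to a biadditive balanced map on `B`. -/
def btensorLift {P : Type*} [AddCommGroup P] (f : A →+* B) (φ : B →+ B →+ P)
    (h : ∀ x a y, φ (x * f a) y = φ x (f a * y)) :
    Tensor A (rightModule f) (leftModule f) →+ P :=
  tensorLift (M := rightModule f) (N := leftModule f) φ h

@[simp]
theorem btensorLift_btmul {P : Type*} [AddCommGroup P] (φ : B →+ B →+ P)
    (h : ∀ x a y, φ (x * f a) y = φ x (f a * y)) (x y : B) :
    btensorLift f φ h (btmul f x y) = φ x y := rfl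

theorem IsRingEpi.tmul_eq (hf : IsRingEpi f) (x y : B) : btmul f x y = btmul f 1 (x * y) := by
  let _ : Module B (Tensor A (rightModule f) (leftModule f)) :=
    Module.compHom _ ((tensorMapEnd (rightModule f) (leftModule f)).comp (mulLeftEnd f))
  have hsmul (b x y : B) : b • btmul f x y = btmul f (b * x) y := rfl
  have h := hf.map_smul (tmulHom (rightModule f) (leftModule f) (1 : B)) (fun a (y : B) => by
    refine (smul_tmul (M := rightModule f) (N := leftModule f) (1 : B) a y).symm.trans ?_
    change btmul f (1 * f a) y = f a • btmul f 1 y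
    rw [hsmul, one_mul, mul_one]) x y
  refine Eq.trans ?_ h.symm
  change _ = x • btmul f 1 y
  rw [hsmul, mul_one]

theorem isRingEpi_of_tmul_comm (h : ∀ b : B, btmul f b 1 = btmul f 1 b) : IsRingEpi f := by
  refine ⟨fun {D} g g' hg => RingCat.hom_ext (RingHom.ext fun b => ?_)⟩
  have hg' (a : A) : g.hom (f a) = g'.hom (f a) :=
    RingHom.congr_fun (congrArg RingCat.Hom.hom hg) a
  let φ : B →+ B →+ D :=
    (AddMonoidHom.mul.comp g.hom.toAddMonoidHom).compl₂ g'.hom.toAddMonoidHom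
  have hφ (x : B) (a : A) (y : B) : φ (x * f a) y = φ x (f a * y) := by
    simp [φ, hg', mul_assoc]
  simpa [φ] using congrArg (btensorLift f φ hφ) (h b)

theorem isRingEpi_of_surjective (hf : Function.Surjective f) : IsRingEpi f :=
  ConcreteCategory.epi_of_surjective (RingCat.ofHom f) hf

theorem IsRingEpi.linearMap_apply (hf : IsRingEpi f) (g : rightModule f →ₗ[Aᵐᵒᵖ] rightModule f)
    (b : B) : (g b : B) = (show B from g (1 : B)) * b := by
  let g' : B →+ B := g.toAddMonoidHom
  have hg' (x : B) (a : A) : g' (x * f a) = g' x * f a := g.map_smul (op a) x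
  let φ : B →+ B →+ B := AddMonoidHom.mul.comp g'
  have hφ (x : B) (a : A) (y : B) : φ (x * f a) y = φ x (f a * y) := by
    simp [φ, hg', mul_assoc]
  have h : g' b * 1 = g' 1 * (b * 1) := congrArg (btensorLift f φ hφ) (hf.tmul_eq b 1)
  rwa [mul_one, mul_one] at h

theorem IsRingEpi.coker_tensor_eq_zero (hf : IsRingEpi f)
    (z : Tensor A (Coker f) (leftModule f)) : z = 0 := by
  induction z using tensor_induction with
  | zero => rfl
  | tmul x y =>
    obtain ⟨x, rfl⟩ := (imageRight f).mkQ_surjective x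
    have hone : (imageRight f).mkQ (1 : B) = 0 :=
      (Submodule.Quotient.mk_eq_zero _).2 ⟨1, map_one f⟩
    have h := congrArg (tensorMap (leftModule f) (imageRight f).mkQ) (hf.tmul_eq x y)
    exact h.trans ((congrArg (tmul · _) hone).trans (zero_tmul (N := leftModule f) _))
  | add x y hx hy => rw [hx, hy, add_zero]

end RingEpimorphism

section Dual

variable {A : Type u} [Ring A] {P Q : Type u} [AddCommGroup P] [Module Aᵐᵒᵖ P]
  [AddCommGroup Q] [Module Aᵐᵒᵖ Q]

instance free_regular_right (A : Type u) [Ring A] : Module.Free Aᵐᵒᵖ A :=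
  Module.Free.of_equiv (opLinearEquiv Aᵐᵒᵖ).symm

instance finite_regular_right (A : Type u) [Ring A] : Module.Finite Aᵐᵒᵖ A :=
  Module.Finite.equiv (opLinearEquiv Aᵐᵒᵖ).symm

/-- The left `A`-module `P* = Hom_A(P, A)` dual to a right `A`-module `P`. -/
abbrev Dual (A P : Type u) [Ring A] [AddCommGroup P] [Module Aᵐᵒᵖ P] : Type u :=
  P →ₗ[Aᵐᵒᵖ] A

/-- The map `Q* → P*` of left `A`-modules dual to `g : P → Q`. -/
abbrev dualMap (g : P →ₗ[Aᵐᵒᵖ] Q) : Dual A Q →ₗ[A] Dual A P :=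
  LinearMap.lcomp A A g

/-- Families `x` in `P` and `h` in `P*` that behave like a dual basis from the point of view of
`P*`: a linear form `φ` is `∑ i, φ (x i) • h i`. -/
def IsDualBasis {ι : Type*} [Fintype ι] (x : ι → P) (h : ι → Dual A P) : Prop :=
  ∀ φ : Dual A P, φ = ∑ i, φ (x i) • h i

theorem isDualBasis_of_sum_eq {ι : Type*} [Fintype ι] {x : ι → P} {h : ι → Dual A P}
    (hxh : ∀ p, p = ∑ i, op (h i p) • x i) : IsDualBasis x h := fun φ =>
  LinearMap.ext fun p => by
    conv_lhs => rw [hxh p]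
    simp

theorem exists_sum_eq (A P : Type u) [Ring A] [AddCommGroup P] [Module Aᵐᵒᵖ P]
    [Module.Finite Aᵐᵒᵖ P] [Module.Projective Aᵐᵒᵖ P] :
    ∃ (n : ℕ) (x : Fin n → P) (h : Fin n → Dual A P), ∀ p, p = ∑ i, op (h i p) • x i := by
  obtain ⟨n, q, s, -, -, hqs⟩ := Module.Finite.exists_comp_eq_id_of_projective Aᵐᵒᵖ P
  let unopEquiv : Aᵐᵒᵖ ≃ₗ[Aᵐᵒᵖ] A := (opLinearEquiv Aᵐᵒᵖ).symm
  refine ⟨n, fun i => q (Pi.single i 1), fun i => unopEquiv ∘ₗ LinearMap.proj i ∘ₗ s,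
    fun p => ?_⟩
  conv_lhs => rw [← LinearMap.id_apply (R := Aᵐᵒᵖ) p, ← hqs, LinearMap.comp_apply,
    pi_eq_sum_univ' (s p), map_sum]
  simp [unopEquiv]

theorem IsDualBasis.projective {ι : Type*} [Fintype ι] {x : ι → P} {h : ι → Dual A P}
    (hxh : IsDualBasis x h) : Module.Projective A (Dual A P) := by
  let coeffs : Dual A P →ₗ[A] ι → A := LinearMap.pi fun i => LinearMap.applyₗ' A (x i)
  refine .of_split coeffs (Fintype.linearCombination A h) (LinearMap.ext fun φ => ?_)
  simpa [Fintype.linearCombination_apply, coeffs] using (hxh φ).symm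

instance projective_dual [Module.Finite Aᵐᵒᵖ P] [Module.Projective Aᵐᵒᵖ P] :
    Module.Projective A (Dual A P) :=
  let ⟨_, _, _, hxh⟩ := exists_sum_eq A P
  (isDualBasis_of_sum_eq hxh).projective

/-- The natural map `M ⊗ P* → Hom_A(P, M)`, `m ⊗ φ ↦ (p ↦ m φ(p))`. -/
def tensorDualHom (M P : Type u) [AddCommGroup M] [Module Aᵐᵒᵖ M] [AddCommGroup P]
    [Module Aᵐᵒᵖ P] : Tensor A M (Dual A P) →+ (P →ₗ[Aᵐᵒᵖ] M) :=
  tensorLift (AddMonoidHom.mk' (fun m => AddMonoidHom.mk' (fun φ =>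
    { toFun := fun p => op (φ p) • m
      map_add' := fun p p' => by simp [add_smul]
      map_smul' := fun a p => by simp [mul_smul] })
    fun φ φ' => LinearMap.ext fun p => by simp [add_smul])
    fun m m' => AddMonoidHom.ext fun φ => LinearMap.ext fun p => by simp)
    fun m a φ => LinearMap.ext fun p => by simp [mul_smul]

variable {M : Type u} [AddCommGroup M] [Module Aᵐᵒᵖ M]

@[simp]
theorem tensorDualHom_tmul (m : M) (φ : Dual A P) (p : P) :
    tensorDualHom M P (tmul m φ) p = op (φ p) • m := rfl

theorem tensorDualHom_bijective [Module.Finite Aᵐᵒᵖ P] [Module.Projective Aᵐᵒᵖ P] :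
    Function.Bijective (tensorDualHom (A := A) M P) := by
  obtain ⟨n, x, h, hxh⟩ := exists_sum_eq A P
  let inv : (P →ₗ[Aᵐᵒᵖ] M) →+ Tensor A M (Dual A P) :=
    ∑ i, ((tmulHom M (Dual A P)).flip (h i)).comp (LinearMap.applyₗ' ℕ (x i)).toAddMonoidHom
  have hinv (g : P →ₗ[Aᵐᵒᵖ] M) : inv g = ∑ i, tmul (g (x i)) (h i) := by
    simp [inv]
  refine Function.bijective_iff_has_inverse.2 ⟨inv, fun z => ?_, fun g => ?_⟩
  · refine DFunLike.congr_fun (tensor_hom_ext (g := inv.comp (tensorDualHom M P))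
      (h := AddMonoidHom.id _) fun m φ => ?_) z
    calc inv (tensorDualHom M P (tmul m φ))
        = ∑ i, tmulHom M (Dual A P) m (φ (x i) • h i) := by simp [hinv, smul_tmul]
      _ = tmul m φ := by rw [← map_sum, ← isDualBasis_of_sum_eq hxh φ, tmulHom_apply]
  · refine LinearMap.ext fun p => ?_
    conv_rhs => rw [hxh p]
    simp [hinv]

theorem tensorDualHom_dualMap (g : P →ₗ[Aᵐᵒᵖ] Q) (z : Tensor A M (Dual A Q)) (p : P) :
    tensorDualHom M P (tensorMapRight M (dualMap g) z) p = tensorDualHom M Q z (g p) := by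
  induction z using tensor_induction with
  | zero => simp
  | tmul m φ => rfl
  | add x y hx hy => simp [hx, hy]

end Dual

section Presentation

variable {A B : Type u} [Ring A] [Ring B] {f : A →+* B} {F : Type u} [AddCommGroup F]
  [Module Aᵐᵒᵖ F] (p : F →ₗ[Aᵐᵒᵖ] rightModule f)

/-- The ring homomorphism `f : A → B` as a homomorphism of right `A`-modules. -/
def unitRight (f : A →+* B) : A →ₗ[Aᵐᵒᵖ] rightModule f where
  toFun a := (f a : B)
  map_add' := f.map_add
  map_smul' c a := f.map_mul a (unop c)

/-- The map `A × F → B`, `(a, v) ↦ f a - p v`. -/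
def presentation : A × F →ₗ[Aᵐᵒᵖ] rightModule f :=
  (unitRight f).coprod (-p)

/-- The pullback of `f` and `p`, which is the module of pairs `(a, v)` with `f a = p v`. When `p` is
surjective it is the kernel both of a presentation `A × F → B` of `B` and, for `f` injective, of
the presentation `F → B / f(A)`. -/
abbrev Relations : Type u := LinearMap.ker (presentation p)

/-- The projection of the pullback `Relations p` to `A`. -/
def relationsFst : Dual A (Relations p) :=
  LinearMap.fst Aᵐᵒᵖ A F ∘ₗ (LinearMap.ker (presentation p)).subtype

/-- The projection of the pullback `Relations p` to `F`. -/
def relationsSnd : Relations p →ₗ[Aᵐᵒᵖ] F :=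
  LinearMap.snd Aᵐᵒᵖ A F ∘ₗ (LinearMap.ker (presentation p)).subtype

/-- The presentation `F → B / f(A)` induced by `p`. -/
def cokerMap : F →ₗ[Aᵐᵒᵖ] Coker f :=
  (imageRight f).mkQ ∘ₗ p

theorem unitRight_comp_relationsFst : unitRight f ∘ₗ relationsFst p = p ∘ₗ relationsSnd p :=
  LinearMap.ext fun k => add_neg_eq_zero.1 k.2

theorem exact_unitRight_mkQ (f : A →+* B) : Function.Exact (unitRight f) (imageRight f).mkQ :=
  fun _ => Submodule.Quotient.mk_eq_zero (imageRight f)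

theorem exact_relationsSnd_cokerMap : Function.Exact (relationsSnd p) (cokerMap p) := fun v => by
  refine (exact_unitRight_mkQ f (p v)).trans ⟨?_, ?_⟩
  · rintro ⟨a, ha⟩
    exact ⟨⟨(a, v), add_neg_eq_zero.2 ha⟩, rfl⟩
  · rintro ⟨k, rfl⟩
    exact ⟨relationsFst p k, LinearMap.congr_fun (unitRight_comp_relationsFst p) k⟩

variable {p}

theorem cokerMap_surjective (hp : Function.Surjective p) : Function.Surjective (cokerMap p) :=
  (imageRight f).mkQ_surjective.comp hp

theorem presentation_surjective (hp : Function.Surjective p) :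
    Function.Surjective (presentation p) := fun b =>
  let ⟨v, hv⟩ := hp (-b)
  ⟨(0, v), by simp [presentation, hv]⟩

theorem tensorMap_unitRight_injective (f : A →+* B) :
    Function.Injective (tensorMap (leftModule f) (unitRight f)) := by
  let φ : B →+ B →+ Tensor A A (leftModule f) :=
    AddMonoidHom.mul.compr₂ (tmulHom A (leftModule f) (1 : A))
  have smul_one (a : A) (b : B) : tmul (1 : A) (show leftModule f from f a * b) =
      tmul a (show leftModule f from b) :=
    (smul_tmul (1 : A) a (show leftModule f from b)).symm.trans (congrArg (tmul · _) (one_mul a))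
  have hφ (x : B) (a : A) (y : B) : φ (x * f a) y = φ x (f a * y) :=
    congrArg (tmul (1 : A)) (mul_assoc x (f a) y)
  refine Function.LeftInverse.injective (g := btensorLift f φ hφ) fun z => ?_
  exact DFunLike.congr_fun (tensor_hom_ext
    (g := (btensorLift f φ hφ).comp (tensorMap (leftModule f) (unitRight f)))
    (h := AddMonoidHom.id _) smul_one) z

-- An element that dies in `F ⊗ B` comes from `A ⊗ B` inside `(A × F) ⊗ B`, and `A ⊗ B → B ⊗ B` is
-- injective.
theorem tensorMap_relationsSnd_injective
    (h : Function.Injective (tensorMap (leftModule f) (LinearMap.ker (presentation p)).subtype)) :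
    Function.Injective (tensorMap (leftModule f) (relationsSnd p)) := by
  refine (injective_iff_map_eq_zero _).2 fun z hz => ?_
  have hdecomp : (LinearMap.ker (presentation p)).subtype =
      LinearMap.inl Aᵐᵒᵖ A F ∘ₗ relationsFst p + LinearMap.inr Aᵐᵒᵖ A F ∘ₗ relationsSnd p :=
    LinearMap.ext fun k => Prod.ext (add_zero _).symm (zero_add _).symm
  have hinl : presentation p ∘ₗ LinearMap.inl Aᵐᵒᵖ A F = unitRight f :=
    LinearMap.coprod_inl _ _
  have hz' : tensorMap (leftModule f) (LinearMap.ker (presentation p)).subtype z =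
      tensorMap _ (LinearMap.inl Aᵐᵒᵖ A F) (tensorMap _ (relationsFst p) z) := by
    rw [hdecomp, tensorMap_add, tensorMap_comp, tensorMap_comp]
    simp [hz]
  have hfst : tensorMap (leftModule f) (relationsFst p) z = 0 := by
    refine tensorMap_unitRight_injective f ?_
    rw [map_zero, ← hinl, tensorMap_comp, AddMonoidHom.comp_apply, ← hz',
      ← AddMonoidHom.comp_apply, ← tensorMap_comp, LinearMap.comp_ker_subtype]
    exact DFunLike.congr_fun (tensor_hom_ext (g := tensorMap _ 0) (h := 0) fun _ => zero_tmul) z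
  exact h (by rw [hz', hfst, map_zero, map_zero])

theorem tensorMap_relationsSnd_bijective [Module.Projective Aᵐᵒᵖ F] (hf : IsRingEpi f)
    (hp : Function.Surjective p) (htor : Limits.IsZero (Tor 1 (rightModule f) (leftModule f))) :
    Function.Bijective (tensorMap (leftModule f) (relationsSnd p)) :=
  ⟨tensorMap_relationsSnd_injective <|
    tensorMap_injective_of_isZero_tor_one _ _ htor (Submodule.subtype_injective _)
      (LinearMap.exact_subtype_ker_map _) (presentation_surjective hp),
    fun z => (tensorMap_exact (exact_relationsSnd_cokerMap p) (cokerMap_surjective hp) z).1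
      (hf.coker_tensor_eq_zero _)⟩

end Presentation

section Adjunction

variable {A B : Type u} [Ring A] [Ring B] {f : A →+* B} {M M' : Type u} [AddCommGroup M]
  [Module Aᵐᵒᵖ M] [AddCommGroup M'] [Module Aᵐᵒᵖ M']

/-- The map `M ⊗ B → B`, `m ⊗ b ↦ g(m) b`, adjoint to `g : M → B`. -/
def tensorEval (g : M →ₗ[Aᵐᵒᵖ] rightModule f) : Tensor A M (leftModule f) →+ B :=
  let g' : M →+ B := g.toAddMonoidHom
  let φ : M →+ B →+ B := AddMonoidHom.mul.comp g'
  tensorLift (N := leftModule f) φ fun m a (b : B) => by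
    have hg' : g' (op a • m) = g' m * f a := g.map_smul (op a) m
    exact (congrArg (· * b) hg').trans (mul_assoc (g' m) (f a) b)

theorem tensorEval_tmul_one (g : M →ₗ[Aᵐᵒᵖ] rightModule f) (m : M) :
    tensorEval g (tmul (N := leftModule f) m (1 : B)) = g m :=
  mul_one (show B from g m)

/-- Right multiplication by `b` as an endomorphism of the left `A`-module `B`. -/
def mulRight (f : A →+* B) (b : B) : leftModule f →ₗ[A] leftModule f where
  toFun x := ((show B from x) * b : B)
  map_add' x y := add_mul (show B from x) (show B from y) b
  map_smul' a x := mul_assoc (f a) (show B from x) b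

theorem tensorEval_mulRight (g : M →ₗ[Aᵐᵒᵖ] rightModule f) (b : B)
    (z : Tensor A M (leftModule f)) :
    tensorEval g (tensorMapRight M (mulRight f b) z) = tensorEval g z * b :=
  DFunLike.congr_fun (tensor_hom_ext
    (g := (tensorEval g).comp (tensorMapRight M (mulRight f b)))
    (h := (AddMonoidHom.mulRight b).comp (tensorEval g))
    fun m (x : B) => (mul_assoc (show B from g m) x b).symm) z

theorem exists_comp_eq_of_tensorMap_bijective {u : M →ₗ[Aᵐᵒᵖ] M'}
    (hu : Function.Bijective (tensorMap (leftModule f) u)) (g : M →ₗ[Aᵐᵒᵖ] rightModule f) :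
    ∃ g' : M' →ₗ[Aᵐᵒᵖ] rightModule f, g' ∘ₗ u = g := by
  let e := AddEquiv.ofBijective _ hu
  have he (m : M) (b : leftModule f) : e.symm (tmul (u m) b) = tmul m b :=
    e.symm_apply_apply (tmul m b)
  have he_mulRight (b : B) (z : Tensor A M' (leftModule f)) :
      e.symm (tensorMapRight M' (mulRight f b) z) =
        tensorMapRight M (mulRight f b) (e.symm z) := by
    obtain ⟨z, rfl⟩ := e.surjective z
    rw [e.symm_apply_apply, e.symm_apply_eq]
    exact tensorMapRight_tensorMap u (mulRight f b) z
  have hsmul (v : M') (a : A) : tmul (N := leftModule f) (op a • v) (1 : B) =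
      tensorMapRight M' (mulRight f (f a)) (tmul (N := leftModule f) v (1 : B)) :=
    (smul_tmul (N := leftModule f) v a (1 : B)).trans
      (congrArg (tmul v) ((mul_one (f a)).trans (one_mul (f a)).symm))
  let g' : M' →+ rightModule f := ((tensorEval g).comp e.symm.toAddMonoidHom).comp
    ((tmulHom M' (leftModule f)).flip (1 : B))
  refine ⟨{ g' with map_smul' := fun c v => ?_ }, LinearMap.ext fun m => ?_⟩
  · refine (congrArg (fun z => tensorEval g (e.symm z)) (hsmul v (unop c))).trans ?_
    rw [he_mulRight, tensorEval_mulRight]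
    rfl
  · exact (congrArg (tensorEval g) (he m _)).trans (tensorEval_tmul_one g m)

theorem comp_injective_of_tensorMap_surjective {u : M →ₗ[Aᵐᵒᵖ] M'}
    (hu : Function.Surjective (tensorMap (leftModule f) u)) :
    Function.Injective fun g : M' →ₗ[Aᵐᵒᵖ] rightModule f => g ∘ₗ u := fun g g' h => by
  have heval : (tensorEval g).comp (tensorMap (leftModule f) u) =
      (tensorEval g').comp (tensorMap (leftModule f) u) :=
    tensor_hom_ext fun m (b : B) => congrArg (fun x : B => x * b) (LinearMap.congr_fun h m)
  refine LinearMap.ext fun v => ?_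
  rw [← tensorEval_tmul_one g, ← tensorEval_tmul_one g']
  exact DFunLike.congr_fun ((AddMonoidHom.cancel_right hu).1 heval) _

end Adjunction

section Connecting

variable {A B : Type u} [Ring A] [Ring B] {f : A →+* B} {F : Type u} [AddCommGroup F]
  [Module Aᵐᵒᵖ F] {p : F →ₗ[Aᵐᵒᵖ] rightModule f}

/-- The graph of the connecting map `Hom_A(K, A) → End_A(B / f(A))`, for `K = Relations p`: the map
`f ∘ φ : K → B` extends along `K → F` to some `g : F → B`, and `g` induces `c` modulo `f(A)`. -/
def IsConnected (p : F →ₗ[Aᵐᵒᵖ] rightModule f) (φ : Dual A (Relations p)) (c : EndCoker f) : Prop :=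
  ∃ g : F →ₗ[Aᵐᵒᵖ] rightModule f,
    g ∘ₗ relationsSnd p = unitRight f ∘ₗ φ ∧ c ∘ₗ cokerMap p = (imageRight f).mkQ ∘ₗ g

theorem isConnected_relationsFst (p : F →ₗ[Aᵐᵒᵖ] rightModule f) :
    IsConnected p (relationsFst p) 1 :=
  ⟨p, (unitRight_comp_relationsFst p).symm, LinearMap.id_comp _⟩

theorem IsConnected.add {φ φ' : Dual A (Relations p)} {c c' : EndCoker f}
    (h : IsConnected p φ c) (h' : IsConnected p φ' c') : IsConnected p (φ + φ') (c + c') := by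
  obtain ⟨g, hg, hc⟩ := h
  obtain ⟨g', hg', hc'⟩ := h'
  exact ⟨g + g', by rw [LinearMap.add_comp, LinearMap.comp_add, hg, hg'],
    by rw [LinearMap.add_comp, LinearMap.comp_add, hc, hc']⟩

theorem IsConnected.smul {φ : Dual A (Relations p)} {c : EndCoker f} (a : A)
    (h : IsConnected p φ c) : IsConnected p (a • φ) (mu f a * c) := by
  obtain ⟨g, hg, hc⟩ := h
  refine ⟨mulLeftRight f a ∘ₗ g, LinearMap.ext fun k => ?_, LinearMap.ext fun v => ?_⟩
  · exact (congrArg (mulLeftRight f a) (LinearMap.congr_fun hg k)).trans (f.map_mul a (φ k)).symm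
  · exact congrArg (mu f a) (LinearMap.congr_fun hc v)

theorem exists_isConnected_of_dual (hp : Function.Surjective p)
    (hu : Function.Bijective (tensorMap (leftModule f) (relationsSnd p)))
    (φ : Dual A (Relations p)) : ∃ c, IsConnected p φ c := by
  obtain ⟨g, hg⟩ := exists_comp_eq_of_tensorMap_bijective hu (unitRight f ∘ₗ φ)
  obtain ⟨c, hc⟩ := exists_descend_of_exact (exact_relationsSnd_cokerMap p)
    (cokerMap_surjective hp) (g := (imageRight f).mkQ ∘ₗ g) (by
      rw [LinearMap.comp_assoc, hg, ← LinearMap.comp_assoc,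
        (exact_unitRight_mkQ f).linearMap_comp_eq_zero, LinearMap.zero_comp])
  exact ⟨c, g, hg, hc⟩

theorem IsConnected.right_unique (hp : Function.Surjective p)
    (hu : Function.Bijective (tensorMap (leftModule f) (relationsSnd p)))
    {φ : Dual A (Relations p)} {c c' : EndCoker f}
    (h : IsConnected p φ c) (h' : IsConnected p φ c') : c = c' := by
  obtain ⟨g, hg, hc⟩ := h
  obtain ⟨g', hg', hc'⟩ := h'
  have hgg' : g = g' := comp_injective_of_tensorMap_surjective hu.2 (hg.trans hg'.symm)
  refine (LinearMap.cancel_right (cokerMap_surjective hp)).1 ?_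
  rw [hc, hc', hgg']

theorem exists_isConnected_of_end [Module.Projective Aᵐᵒᵖ F] (hinj : Function.Injective f)
    (c : EndCoker f) : ∃ φ : Dual A (Relations p), IsConnected p φ c := by
  obtain ⟨g, hg⟩ := Module.projective_lifting_property (imageRight f).mkQ (c ∘ₗ cokerMap p)
    (imageRight f).mkQ_surjective
  obtain ⟨φ, hφ⟩ := exists_lift_of_exact (d := unitRight f) hinj (exact_unitRight_mkQ f)
    (g := g ∘ₗ relationsSnd p) (by
      rw [← LinearMap.comp_assoc, hg, LinearMap.comp_assoc,
        (exact_relationsSnd_cokerMap p).linearMap_comp_eq_zero, LinearMap.comp_zero])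
  exact ⟨φ, g, hφ.symm, hg.symm⟩

theorem isConnected_zero_iff (hinj : Function.Injective f)
    {φ : Dual A (Relations p)} :
    IsConnected p φ 0 ↔ φ ∈ LinearMap.range (dualMap (relationsSnd p)) := by
  constructor
  · rintro ⟨g, hg, hc⟩
    obtain ⟨ψ, hψ⟩ := exists_lift_of_exact (d := unitRight f) hinj (exact_unitRight_mkQ f)
      (hc.symm.trans (LinearMap.zero_comp _))
    refine ⟨ψ, (LinearMap.cancel_left (f := unitRight f) hinj).1 ?_⟩
    rw [← hg, ← hψ]
    rfl
  · rintro ⟨ψ, rfl⟩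
    refine ⟨unitRight f ∘ₗ ψ, rfl, ?_⟩
    rw [LinearMap.zero_comp, ← LinearMap.comp_assoc,
      (exact_unitRight_mkQ f).linearMap_comp_eq_zero, LinearMap.zero_comp]

theorem dualMap_relationsSnd_injective (hinj : Function.Injective f)
    (hu : Function.Surjective (tensorMap (leftModule f) (relationsSnd p))) :
    Function.Injective (dualMap (A := A) (relationsSnd p)) := fun _ _ h =>
  (LinearMap.cancel_left (f := unitRight f) hinj).1 <|
    comp_injective_of_tensorMap_surjective hu (congrArg (unitRight f ∘ₗ ·) h)

/-- The connecting map `Hom_A(K, A) → End_A(B / f(A))` for `K = Relations p`, which is the cokernel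
of `Hom_A(F, A) → Hom_A(K, A)`. -/
def connecting (hp : Function.Surjective p)
    (hu : Function.Bijective (tensorMap (leftModule f) (relationsSnd p))) :
    Dual A (Relations p) →ₗ[A] leftModule (mu f) :=
  let conn (φ : Dual A (Relations p)) := (exists_isConnected_of_dual hp hu φ).choose
  have hconn (φ : Dual A (Relations p)) : IsConnected p φ (conn φ) :=
    (exists_isConnected_of_dual hp hu φ).choose_spec
  { toFun := conn
    map_add' := fun φ ψ => (hconn (φ + ψ)).right_unique hp hu ((hconn φ).add (hconn ψ))
    map_smul' := fun a φ => (hconn (a • φ)).right_unique hp hu ((hconn φ).smul a) }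

section

variable (hp : Function.Surjective p)
  (hu : Function.Bijective (tensorMap (leftModule f) (relationsSnd p)))

theorem connecting_eq_iff {φ : Dual A (Relations p)} {c : EndCoker f} :
    connecting hp hu φ = c ↔ IsConnected p φ c :=
  have h : IsConnected p φ (connecting hp hu φ) := (exists_isConnected_of_dual hp hu φ).choose_spec
  ⟨fun hc => hc ▸ h, h.right_unique hp hu⟩

theorem connecting_surjective [Module.Projective Aᵐᵒᵖ F] (hinj : Function.Injective f) :
    Function.Surjective (connecting hp hu) := fun c =>
  (exists_isConnected_of_end hinj c).imp fun _ => (connecting_eq_iff hp hu).2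

theorem exact_dualMap_connecting (hinj : Function.Injective f) :
    Function.Exact (dualMap (relationsSnd p)) (connecting hp hu) := fun _ =>
  (connecting_eq_iff hp hu).trans (isConnected_zero_iff hinj)

end

end Connecting

section HomologicalEpimorphism

variable {A B : Type u} [Ring A] [Ring B] {f : A →+* B} {F : Type u} [AddCommGroup F]
  [Module Aᵐᵒᵖ F] {p : F →ₗ[Aᵐᵒᵖ] rightModule f}

-- Such a `g` is adjoint to a map `B / f(A) ⊗ B → B / f(A)`, and `B / f(A) ⊗ B = 0`.
theorem IsRingEpi.hom_coker_endCoker_eq_zero (hf : IsRingEpi f)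
    (g : Coker f →ₗ[Aᵐᵒᵖ] rightModule (mu f)) : g = 0 := by
  let mk : B →+ Coker f := (imageRight f).mkQ.toAddMonoidHom
  let g' : Coker f →+ B →+ Coker f :=
    { toFun := fun x => (show EndCoker f from g x).toAddMonoidHom.comp mk
      map_zero' := by rw [map_zero]; rfl
      map_add' := fun x x' => by rw [map_add]; rfl }
  have hg' (x : Coker f) (a : A) (y : B) : g' (op a • x) y = g' x (f a * y) :=
    congrArg (fun c : EndCoker f => c (mk y)) (g.map_smul (op a) x)
  refine LinearMap.ext fun x => LinearMap.ext fun y => ?_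
  obtain ⟨y, rfl⟩ := (imageRight f).mkQ_surjective y
  have h : tmul (N := leftModule f) x y = 0 := hf.coker_tensor_eq_zero _
  exact (congrArg (tensorLift (N := leftModule f) g' hg') h).trans (map_zero _)

theorem tensorMapRight_dualMap_injective [Module.Finite Aᵐᵒᵖ F] [Module.Projective Aᵐᵒᵖ F]
    (hf : IsRingEpi f) (hp : Function.Surjective p) :
    Function.Injective (tensorMapRight (rightModule (mu f)) (dualMap (relationsSnd p))) := by
  refine (injective_iff_map_eq_zero _).2 fun z hz => ?_
  refine (map_eq_zero_iff _ tensorDualHom_bijective.1).1 ?_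
  obtain ⟨g, hg⟩ := exists_descend_of_exact (exact_relationsSnd_cokerMap p)
    (cokerMap_surjective hp) (g := tensorDualHom (rightModule (mu f)) F z)
    (LinearMap.ext fun k => by
      rw [LinearMap.comp_apply, ← tensorDualHom_dualMap, hz, map_zero])
  rw [← hg, hf.hom_coker_endCoker_eq_zero g, LinearMap.zero_comp]

-- The map `v ↦ (y ↦ g(v) y - c (p(v) y))`, with `g` as in `IsConnected`.
theorem IsConnected.exists_extension {φ : Dual A (Relations p)} {c : EndCoker f}
    (h : IsConnected p φ c) : ∃ ext : F →ₗ[Aᵐᵒᵖ] rightModule (mu f), ∀ k,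
      ext (relationsSnd p k) = mu f (φ k) - c * mu f (relationsFst p k) := by
  obtain ⟨g, hg, hc⟩ := h
  let act : F →+ (rightModule f →ₗ[Aᵐᵒᵖ] Coker f) := AddMonoidHom.mk'
    (fun v => (imageRight f).mkQ ∘ₗ mulLeftEnd f (g v) -
      c ∘ₗ (imageRight f).mkQ ∘ₗ mulLeftEnd f (p v)) fun v w => by
    have hadd (h : F →ₗ[Aᵐᵒᵖ] rightModule f) : mulLeftEnd f (h (v + w)) =
        mulLeftEnd f (h v) + mulLeftEnd f (h w) := by
      rw [map_add]
      exact (mulLeftEnd f).map_add _ _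
    rw [hadd, hadd, LinearMap.comp_add, LinearMap.comp_add, LinearMap.comp_add, add_sub_add_comm]
  have act_apply (v : F) (y : B) : act v y = (imageRight f).mkQ ((show B from g v) * y : B) -
    c ((imageRight f).mkQ ((show B from p v) * y : B)) := rfl
  have act_smul (v : F) (a : A) (y : B) : act (op a • v) y = act v (f a * y : B) := by
    rw [act_apply, act_apply, map_smul, map_smul, ← mul_assoc, ← mul_assoc]
    rfl
  have act_image (v : F) (a : A) : act v (f a : B) = 0 := by
    rw [← mul_one (f a), ← act_smul, act_apply, mul_one, mul_one]
    exact sub_eq_zero.2 (LinearMap.congr_fun hc (op a • v)).symm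
  let ext : F →ₗ[Aᵐᵒᵖ] rightModule (mu f) :=
    { toFun := fun v => (imageRight f).liftQ (act v) (by
        rintro _ ⟨a, rfl⟩
        exact act_image v a)
      map_add' := fun v w => Submodule.linearMap_qext _ (map_add act v w)
      map_smul' := fun a v => Submodule.linearMap_qext _ (LinearMap.ext (act_smul v (unop a))) }
  refine ⟨ext, fun k => Submodule.linearMap_qext _ (LinearMap.ext fun y : B => ?_)⟩
  refine (act_apply _ y).trans ?_
  have hgk : g (relationsSnd p k) = f (φ k) := LinearMap.congr_fun hg k
  have hpk : p (relationsSnd p k) = f (relationsFst p k) :=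
    (LinearMap.congr_fun (unitRight_comp_relationsFst p) k).symm
  rw [hgk, hpk]
  rfl

theorem IsConnected.tmul_sub_tmul_mem_range [Module.Finite Aᵐᵒᵖ F] [Module.Projective Aᵐᵒᵖ F]
    [Module.Finite Aᵐᵒᵖ (Relations p)] [Module.Projective Aᵐᵒᵖ (Relations p)]
    {φ : Dual A (Relations p)} {c : EndCoker f} (h : IsConnected p φ c) :
    tmul (M := rightModule (mu f)) (1 : EndCoker f) φ -
        tmul (M := rightModule (mu f)) c (relationsFst p) ∈
      (tensorMapRight (rightModule (mu f)) (dualMap (relationsSnd p))).range := by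
  obtain ⟨ext, hext⟩ := h.exists_extension
  obtain ⟨t, ht⟩ := tensorDualHom_bijective.2 ext
  refine ⟨t, tensorDualHom_bijective.1 (LinearMap.ext fun k => ?_)⟩
  rw [tensorDualHom_dualMap, ht, hext, map_sub, LinearMap.sub_apply]
  exact congrArg (· - c * mu f (relationsFst p k)) (one_mul (mu f (φ k))).symm

theorem isRingEpi_mu [Module.Finite Aᵐᵒᵖ F] [Module.Projective Aᵐᵒᵖ F]
    [Module.Finite Aᵐᵒᵖ (Relations p)] [Module.Projective Aᵐᵒᵖ (Relations p)]
    (hinj : Function.Injective f) (hp : Function.Surjective p)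
    (hu : Function.Bijective (tensorMap (leftModule f) (relationsSnd p))) :
    IsRingEpi (mu f) := by
  refine isRingEpi_of_tmul_comm fun c => ?_
  obtain ⟨φ, hφ⟩ := connecting_surjective hp hu hinj c
  obtain ⟨t, ht⟩ := ((connecting_eq_iff hp hu).1 hφ).tmul_sub_tmul_mem_range
  have hfst : connecting hp hu (relationsFst p) = (1 : EndCoker f) :=
    (connecting_eq_iff hp hu).2 (isConnected_relationsFst p)
  have h := (tensorMapRight_exact (M := rightModule (mu f)) (exact_dualMap_connecting hp hu hinj)
    (connecting_surjective hp hu hinj) _).2 ⟨t, ht⟩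
  rw [map_sub, sub_eq_zero] at h
  calc btmul (mu f) c 1 = btmul (mu f) c (connecting hp hu (relationsFst p)) := by rw [hfst]
    _ = btmul (mu f) 1 (connecting hp hu φ) := h.symm
    _ = btmul (mu f) 1 c := by rw [hφ]

theorem isHomologicalEpi_mu [Module.Finite Aᵐᵒᵖ F] [Module.Projective Aᵐᵒᵖ F]
    [Module.Finite Aᵐᵒᵖ (Relations p)] [Module.Projective Aᵐᵒᵖ (Relations p)]
    (hinj : Function.Injective f) (hf : IsRingEpi f) (hp : Function.Surjective p)
    (hu : Function.Bijective (tensorMap (leftModule f) (relationsSnd p))) :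
    IsHomologicalEpi (mu f) :=
  ⟨isRingEpi_mu hinj hp hu, fun _ => isZero_tor_of_projective_resolution _ _
    (dualMap_relationsSnd_injective hinj hu.2) (exact_dualMap_connecting hp hu hinj)
    (connecting_surjective hp hu hinj) (tensorMapRight_dualMap_injective hf hp)⟩

end HomologicalEpimorphism

section ProjectiveDimension

variable {R : Type u} [Ring R] {X Y : Type u} [AddCommGroup X] [Module R X] [AddCommGroup Y]
  [Module R Y] {Z : ModuleCat.{u} R} {d : X →ₗ[R] Y} {e : Y →ₗ[R] Z}

/-- The short complex of modules given by an exact pair of linear maps. -/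
abbrev shortComplex (hde : Function.Exact d e) : ShortComplex (ModuleCat.{u} R) :=
  ShortComplex.mk (ModuleCat.ofHom d) (ModuleCat.ofHom e)
    (ModuleCat.hom_ext hde.linearMap_comp_eq_zero)

theorem shortExact_shortComplex (hd : Function.Injective d) (hde : Function.Exact d e)
    (he : Function.Surjective e) : (shortComplex hde).ShortExact where
  exact := (ShortComplex.ShortExact.moduleCat_exact_iff_function_exact _).2 hde
  mono_f := (ModuleCat.mono_iff_injective _).2 hd
  epi_g := (ModuleCat.epi_iff_surjective _).2 he

theorem hasProjectiveDimensionLE_one_iff [Module.Projective R Y] (hd : Function.Injective d)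
    (hde : Function.Exact d e) (he : Function.Surjective e) :
    HasProjectiveDimensionLE Z 1 ↔ Module.Projective R X := by
  have hY : Projective (shortComplex hde).X₂ := (IsProjective.iff_projective Y).1 inferInstance
  rw [IsProjective.iff_projective, projective_iff_hasProjectiveDimensionLT_one]
  exact (shortExact_shortComplex hd hde he).hasProjectiveDimensionLT_X₃_iff 0 hY

end ProjectiveDimension

section Ext

variable {A : Type u} [Ring A] {K G : Type u} [AddCommGroup K] [Module Aᵐᵒᵖ K] [AddCommGroup G]
  [Module Aᵐᵒᵖ G] {M : ModuleCat.{u} Aᵐᵒᵖ} {κ : K →ₗ[Aᵐᵒᵖ] G} {q : G →ₗ[Aᵐᵒᵖ] M}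
  (hκ : Function.Injective κ) (hκq : Function.Exact κ q) (hq : Function.Surjective q)

/-- The connecting map `K* → Ext¹(M, A)` of the short exact sequence `0 → K → G → M → 0`. -/
def extConnecting : Dual A K →ₗ[A] extLeft M 1 where
  toFun φ := (shortExact_shortComplex hκ hκq hq).extClass.comp
    (Abelian.Ext.mk₀ (ModuleCat.ofHom φ)) (add_zero 1)
  map_add' φ ψ := by
    rw [ModuleCat.ofHom_add, Abelian.Ext.mk₀_add, Abelian.Ext.comp_add]
    rfl
  map_smul' a φ := by
    have hsmul : ModuleCat.ofHom (a • φ) = ModuleCat.ofHom φ ≫ regularMulLeft a := rfl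
    rw [hsmul, ← Abelian.Ext.mk₀_comp_mk₀]
    exact (Abelian.Ext.comp_assoc_of_third_deg_zero _ _ _ _).symm

theorem extConnecting_surjective [Module.Projective Aᵐᵒᵖ G] :
    Function.Surjective (extConnecting hκ hκq hq) := fun x => by
  have hG : Projective (shortComplex hκq).X₂ := (IsProjective.iff_projective G).1 inferInstance
  obtain ⟨y, hy⟩ := Abelian.Ext.contravariant_sequence_exact₃ (shortExact_shortComplex hκ hκq hq)
    (ModuleCat.of Aᵐᵒᵖ A) (show Abelian.Ext.{u} M (ModuleCat.of Aᵐᵒᵖ A) 1 from x)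
    (Abelian.Ext.eq_zero_of_projective _) (add_zero 1)
  obtain ⟨φ, rfl⟩ := Abelian.Ext.homEquiv₀.symm.surjective y
  exact ⟨φ.hom, hy⟩

theorem exact_dualMap_extConnecting :
    Function.Exact (dualMap κ) (extConnecting hκ hκq hq) := fun φ => by
  have hS := shortExact_shortComplex hκ hκq hq
  constructor
  · intro hφ
    obtain ⟨y, hy⟩ := Abelian.Ext.contravariant_sequence_exact₁ hS (ModuleCat.of Aᵐᵒᵖ A)
      (Abelian.Ext.mk₀ (ModuleCat.ofHom φ)) (add_zero 1) hφ
    obtain ⟨ψ, rfl⟩ := Abelian.Ext.homEquiv₀.symm.surjective y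
    rw [Abelian.Ext.homEquiv₀_symm_apply, Abelian.Ext.mk₀_comp_mk₀] at hy
    exact ⟨ψ.hom, congrArg ModuleCat.Hom.hom (Abelian.Ext.homEquiv₀.symm.injective hy)⟩
  · rintro ⟨ψ, rfl⟩
    have hcomp : ModuleCat.ofHom (dualMap κ ψ) = (shortComplex hκq).f ≫ ModuleCat.ofHom ψ := rfl
    change hS.extClass.comp (Abelian.Ext.mk₀ (ModuleCat.ofHom (dualMap κ ψ))) (add_zero 1) = 0
    rw [hcomp, ← Abelian.Ext.mk₀_comp_mk₀]
    exact hS.extClass_comp_assoc _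

end Ext

section DualBasis

variable {A : Type u} [Ring A] {K G M : Type u} [AddCommGroup K] [Module Aᵐᵒᵖ K] [AddCommGroup G]
  [Module Aᵐᵒᵖ G] [AddCommGroup M] [Module Aᵐᵒᵖ M] {κ : K →ₗ[Aᵐᵒᵖ] G} {q : G →ₗ[Aᵐᵒᵖ] M}

theorem dualMap_injective (hq : Function.Surjective q) :
    Function.Injective (dualMap (A := A) q) := fun _ _ => (LinearMap.cancel_right hq).1

theorem dualMap_exact (hκq : Function.Exact κ q) (hq : Function.Surjective q) :
    Function.Exact (dualMap (A := A) q) (dualMap κ) := fun φ => by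
  constructor
  · exact fun hφ => exists_descend_of_exact hκq hq hφ
  · rintro ⟨ψ, rfl⟩
    exact (LinearMap.comp_assoc κ q ψ).trans (by
      rw [hκq.linearMap_comp_eq_zero, LinearMap.comp_zero])

theorem IsDualBasis.of_retraction {ι : Type*} [Fintype ι] {x : ι → G} {h : ι → Dual A G}
    (hxh : IsDualBasis x h) {r : Dual A G →ₗ[A] Dual A M} (hr : r ∘ₗ dualMap q = LinearMap.id) :
    IsDualBasis (q ∘ x) (r ∘ h) := fun φ => by
  calc φ = r (dualMap q φ) := (LinearMap.congr_fun hr φ).symm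
    _ = ∑ i, φ (q (x i)) • r (h i) := by
      conv_lhs => rw [hxh (dualMap q φ)]
      simp
    _ = ∑ i, φ ((q ∘ x) i) • (r ∘ h) i := rfl

theorem exists_isDualBasis_of_projective_range [Module.Finite Aᵐᵒᵖ G] [Module.Projective Aᵐᵒᵖ G]
    (hκq : Function.Exact κ q) (hq : Function.Surjective q)
    [Module.Projective A (LinearMap.range (dualMap (A := A) κ))] :
    ∃ (n : ℕ) (x : Fin n → M) (h : Fin n → Dual A M), IsDualBasis x h := by
  obtain ⟨s, hs⟩ := Module.projective_lifting_property (dualMap (A := A) κ).rangeRestrict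
    LinearMap.id (dualMap κ).surjective_rangeRestrict
  have htfae := Function.Exact.split_tfae' (R := A) (M := Dual A M) (N := Dual A G)
    (exact_rangeRestrict (dualMap_exact (A := A) hκq hq))
  obtain ⟨-, r, hr⟩ := (htfae.out 0 1 rfl rfl).1 ⟨dualMap_injective hq, s, hs⟩
  obtain ⟨n, x, h, hxh⟩ := exists_sum_eq A G
  exact ⟨n, q ∘ x, r ∘ h, (isDualBasis_of_sum_eq hxh).of_retraction hr⟩

end DualBasis

section Kernel

variable {A B : Type u} [Ring A] [Ring B] {f : A →+* B}

theorem mem_ker_mu_iff {a : A} : a ∈ RingHom.ker (mu f) ↔ ∀ y : B, ∃ a', f a' = f a * y :=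
  ⟨fun ha y => (Submodule.Quotient.mk_eq_zero (imageRight f)).1
    (LinearMap.congr_fun (RingHom.mem_ker.1 ha) ((imageRight f).mkQ y)),
    fun h => RingHom.mem_ker.2 <| Submodule.linearMap_qext _ <| LinearMap.ext fun y =>
      (Submodule.Quotient.mk_eq_zero (imageRight f)).2 (h y)⟩

/-- Evaluation at `1` on the dual of the right `A`-module `B`. -/
def evalOne (f : A →+* B) : Dual A (rightModule f) →ₗ[A] A :=
  LinearMap.applyₗ' A (show rightModule f from (1 : B))

theorem IsRingEpi.map_dual_apply (hf : IsRingEpi f) (φ : Dual A (rightModule f)) (b : B) :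
    f (φ b) = f (evalOne f φ) * b :=
  hf.linearMap_apply (unitRight f ∘ₗ φ) b

theorem evalOne_injective (hinj : Function.Injective f) (hf : IsRingEpi f) :
    Function.Injective (evalOne f) := fun φ ψ h =>
  LinearMap.ext fun b : B => hinj <| by
    calc f (φ b) = f (evalOne f φ) * b := hf.map_dual_apply φ b
      _ = f (evalOne f ψ) * b := by rw [h]
      _ = f (ψ b) := (hf.map_dual_apply ψ b).symm

theorem range_evalOne (hinj : Function.Injective f) (hf : IsRingEpi f) :
    LinearMap.range (evalOne f) = RingHom.ker (mu f) := by
  refine SetLike.ext fun a => ⟨?_, fun ha => ?_⟩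
  · rintro ⟨φ, rfl⟩
    exact mem_ker_mu_iff.2 fun y => ⟨φ y, hf.map_dual_apply φ y⟩
  · obtain ⟨φ, hφ⟩ := exists_lift_of_exact (d := unitRight f) hinj (exact_unitRight_mkQ f)
      (g := mulLeftRight f a) (LinearMap.ext fun y =>
        (Submodule.Quotient.mk_eq_zero (imageRight f)).2 (mem_ker_mu_iff.1 ha y))
    exact ⟨φ, hinj ((LinearMap.congr_fun hφ (1 : B)).trans (mul_one (f a)))⟩

theorem projective_ker_mu (hinj : Function.Injective f) (hf : IsRingEpi f) {ι : Type*} [Fintype ι]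
    {x : ι → rightModule f} {h : ι → Dual A (rightModule f)} (hxh : IsDualBasis x h) :
    Module.Projective A (RingHom.ker (mu f)) := by
  have := hxh.projective
  exact Module.Projective.of_equiv ((LinearEquiv.ofInjective _ (evalOne_injective hinj hf)).trans
    (LinearEquiv.ofEq _ _ (range_evalOne hinj hf)))

theorem ker_mu_mul_self (hinj : Function.Injective f) (hf : IsRingEpi f) {ι : Type*} [Fintype ι]
    {x : ι → rightModule f} {h : ι → Dual A (rightModule f)} (hxh : IsDualBasis x h) :
    RingHom.ker (mu f) * RingHom.ker (mu f) = RingHom.ker (mu f) := by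
  have evalOne_mem (φ : Dual A (rightModule f)) : evalOne f φ ∈ RingHom.ker (mu f) :=
    range_evalOne hinj hf ▸ LinearMap.mem_range_self _ φ
  have apply_mem (φ : Dual A (rightModule f)) (y : B) : φ y ∈ RingHom.ker (mu f) := by
    have hy : evalOne f (φ ∘ₗ mulLeftEnd f y) = φ y := congrArg φ (mul_one y)
    exact hy ▸ evalOne_mem _
  refine le_antisymm Ideal.mul_le_left fun a ha => ?_
  obtain ⟨φ, rfl⟩ : a ∈ LinearMap.range (evalOne f) := (range_evalOne hinj hf).symm ▸ ha
  rw [hxh φ, map_sum]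
  exact sum_mem fun i _ => Ideal.mul_mem_mul (apply_mem φ (x i)) (evalOne_mem (h i))

end Kernel

section IdempotentIdeals

variable {A : Type u} [Ring A]

theorem isTwoSided_span_mul_mul (e : A) :
    (Ideal.span {x | ∃ a b : A, x = a * e * b}).IsTwoSided where
  mul_mem_of_left {y} c hy := by
    induction hy using Submodule.span_induction with
    | mem y hy =>
      obtain ⟨a, b, rfl⟩ := hy
      exact Ideal.subset_span ⟨a, b * c, mul_assoc _ _ _⟩
    | zero => exact (zero_mul c).symm ▸ zero_mem _
    | add y z _ _ hy hz => exact (add_mul y z c).symm ▸ add_mem hy hz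
    | smul a y _ hy => exact (mul_assoc a y c).symm ▸ Ideal.mul_mem_left _ a hy

theorem le_sup_pow_of_le_mul_self {I K J : Ideal A} [K.IsTwoSided] [J.IsTwoSided]
    (hI : I ≤ I * I) (h : I ≤ K ⊔ J) (n : ℕ) : I ≤ K ⊔ J ^ n := by
  induction n with
  | zero => exact le_top.trans (by rw [Submodule.pow_zero, Ideal.one_eq_top, sup_top_eq])
  | succ n ih =>
    calc I ≤ (K ⊔ J) * (K ⊔ J ^ n) := hI.trans (Ideal.mul_mono h ih)
      _ = K * (K ⊔ J ^ n) ⊔ (J * K ⊔ J * J ^ n) := by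
        rw [Ideal.sup_mul, Ideal.mul_sup J K (J ^ n)]
      _ ≤ K ⊔ J * J ^ n :=
        sup_le (Ideal.mul_le_left.trans le_sup_left) (sup_le_sup_right Ideal.mul_le_right _)
      _ = K ⊔ J ^ (n + 1) := by rw [Ideal.IsTwoSided.pow_succ]

theorem exists_isIdempotentElem_mem_le_span_sup_jacobson [IsSemiprimaryRing A] (I : Ideal A)
    [I.IsTwoSided] :
    ∃ e ∈ I, IsIdempotentElem e ∧ I ≤ Ideal.span {e} ⊔ Ring.jacobson A := by
  let J := Ring.jacobson A
  obtain ⟨n, hn⟩ := IsSemiprimaryRing.isNilpotent (R := A)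
  have hmk := Ideal.Quotient.mk_surjective (I := J)
  obtain ⟨ē, hē, hspan⟩ :=
    IsSemisimpleRing.ideal_eq_span_idempotent (I.map (Ideal.Quotient.mk J))
  obtain ⟨x, hxI, hx⟩ := (Ideal.mem_map_iff_of_surjective _ hmk).1
    (hspan ▸ Ideal.mem_span_singleton_self ē : ē ∈ I.map (Ideal.Quotient.mk J))
  have hxJ : x - x ^ 2 ∈ J := by
    rw [← Ideal.Quotient.eq_zero_iff_mem, map_sub, map_pow, hx, pow_two, hē.eq, sub_self]
  have hnil : (x - x ^ 2) ^ (n + 1) = 0 := by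
    rw [pow_succ, (hn ▸ Ideal.pow_mem_pow hxJ n : (x - x ^ 2) ^ n ∈ (0 : Ideal A)), zero_mul]
  let e := 1 - (1 - x ^ (n + 1)) ^ (n + 1)
  have heI : e ∈ I := by
    rw [← Ideal.Quotient.eq_zero_iff_mem]
    simp [e, Ideal.Quotient.eq_zero_iff_mem.2 hxI]
  have heē : Ideal.Quotient.mk J e = ē := by
    simp only [e, map_sub, map_one, map_pow, hx, hē.pow_succ_eq, hē.one_sub.pow_succ_eq,
      sub_sub_cancel]
  refine ⟨e, heI, isIdempotentElem_one_sub_one_sub_pow_pow x (n + 1) hnil, fun y hy => ?_⟩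
  obtain ⟨r, hr⟩ := Ideal.mem_span_singleton'.1
    (hspan ▸ Ideal.mem_map_of_mem _ hy : Ideal.Quotient.mk J y ∈ Ideal.span {ē})
  obtain ⟨r, rfl⟩ := hmk r
  refine Submodule.mem_sup.2 ⟨r * e, Ideal.mem_span_singleton'.2 ⟨r, rfl⟩, y - r * e, ?_,
    add_sub_cancel _ _⟩
  rw [← Ideal.Quotient.eq_zero_iff_mem, map_sub, map_mul, heē, hr, sub_self]

theorem exists_isIdempotentElem_eq_span_of_mul_self [IsSemiprimaryRing A] (I : Ideal A)
    [I.IsTwoSided] (hI : I * I = I) :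
    ∃ e : A, IsIdempotentElem e ∧ I = Ideal.span {x | ∃ a b : A, x = a * e * b} := by
  obtain ⟨e, heI, he, hle⟩ := exists_isIdempotentElem_mem_le_span_sup_jacobson I
  obtain ⟨n, hn⟩ := IsSemiprimaryRing.isNilpotent (R := A)
  have := isTwoSided_span_mul_mul e
  have he_mem : e ∈ Ideal.span {x | ∃ a b : A, x = a * e * b} :=
    Ideal.subset_span ⟨1, 1, by rw [one_mul, mul_one]⟩
  refine ⟨e, he, le_antisymm ?_ (Ideal.span_le.2 ?_)⟩
  · have h := le_sup_pow_of_le_mul_self hI.ge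
      (hle.trans (sup_le_sup_right ((Ideal.span_singleton_le_iff_mem _).2 he_mem) _)) n
    rwa [hn, Ideal.zero_eq_bot, sup_bot_eq] at h
  · rintro _ ⟨a, b, rfl⟩
    exact I.mul_mem_right _ (I.mul_mem_left _ heI)

theorem tensor_eq_zero_of_smul_eq_zero {M : Type u} [AddCommGroup M] [Module Aᵐᵒᵖ M] {I : Ideal A}
    (hI : I * I = I) (hM : ∀ a ∈ I, ∀ m : M, op a • m = 0) (z : Tensor A M I) : z = 0 := by
  have htmul (m : M) (a : A) (ha : a ∈ I * I) (ha' : a ∈ I) :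
      tmul (A := A) m (⟨a, ha'⟩ : I) = 0 := by
    induction ha using Submodule.mul_induction_on' with
    | mem_mul_mem b hb c hc =>
      have hbc : (⟨b * c, ha'⟩ : I) = b • ⟨c, hc⟩ := rfl
      rw [hbc, ← smul_tmul, hM b hb, zero_tmul]
    | add b hb c hc ihb ihc =>
      exact (tmul_add (N := I) m ⟨b, hI ▸ hb⟩ ⟨c, hI ▸ hc⟩).trans (by rw [ihb, ihc, add_zero])
  induction z using tensor_induction with
  | zero => rfl
  | tmul m a => exact htmul m a (hI.symm ▸ a.2) a.2
  | add x y hx hy => rw [hx, hy, add_zero]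

theorem isHomologicalEpi_quotient_mk (I : Ideal A) [I.IsTwoSided] (hI : I * I = I)
    [Module.Projective A I] : IsHomologicalEpi (Ideal.Quotient.mk I) := by
  let mk : A →ₗ[A] leftModule (Ideal.Quotient.mk I) :=
    { toFun := Ideal.Quotient.mk I
      map_add' := map_add (Ideal.Quotient.mk I)
      map_smul' := map_mul (Ideal.Quotient.mk I) }
  have hexact : Function.Exact I.subtype mk := fun x =>
    Ideal.Quotient.eq_zero_iff_mem.trans (Set.ext_iff.1 Subtype.range_coe x).symm
  have hsmul (a : A) (ha : a ∈ I) (x : A ⧸ I) : x * Ideal.Quotient.mk I a = 0 := by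
    rw [Ideal.Quotient.eq_zero_iff_mem.2 ha, mul_zero]
  have hzero := tensor_eq_zero_of_smul_eq_zero (M := rightModule (Ideal.Quotient.mk I)) hI hsmul
  exact ⟨isRingEpi_of_surjective Ideal.Quotient.mk_surjective, fun _ =>
    isZero_tor_of_projective_resolution _ _ (Submodule.subtype_injective I) hexact
      Ideal.Quotient.mk_surjective fun z z' _ => (hzero z).trans (hzero z').symm⟩

end IdempotentIdeals

section Assembly

variable {A B : Type u} [Ring A] [Ring B] {f : A →+* B} {F : Type u} [AddCommGroup F]
  [Module Aᵐᵒᵖ F] {p : F →ₗ[Aᵐᵒᵖ] rightModule f}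

theorem projective_relations [Module.Projective Aᵐᵒᵖ F] (hp : Function.Surjective p)
    (hpd : HasProjectiveDimensionLE (rightModule f) 1) : Module.Projective Aᵐᵒᵖ (Relations p) :=
  (hasProjectiveDimensionLE_one_iff (Submodule.subtype_injective _)
    (LinearMap.exact_subtype_ker_map _) (presentation_surjective hp)).1 hpd

theorem finite_relations [Module.Finite Aᵐᵒᵖ F] [Module.FinitePresentation Aᵐᵒᵖ (rightModule f)]
    (hp : Function.Surjective p) : Module.Finite Aᵐᵒᵖ (Relations p) :=
  Module.Finite.iff_fg.2 (Module.FinitePresentation.fg_ker _ (presentation_surjective hp))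

theorem hasProjectiveDimensionLE_mu [Module.Finite Aᵐᵒᵖ F] [Module.Projective Aᵐᵒᵖ F]
    [Module.Finite Aᵐᵒᵖ (Relations p)] [Module.Projective Aᵐᵒᵖ (Relations p)]
    (hinj : Function.Injective f) (hp : Function.Surjective p)
    (hu : Function.Bijective (tensorMap (leftModule f) (relationsSnd p))) :
    HasProjectiveDimensionLE (leftModule (mu f)) 1 :=
  (hasProjectiveDimensionLE_one_iff (dualMap_relationsSnd_injective hinj hu.2)
    (exact_dualMap_connecting hp hu hinj) (connecting_surjective hp hu hinj)).2 inferInstance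

theorem exists_isDualBasis_of_ext [Module.Finite Aᵐᵒᵖ F] [Module.Projective Aᵐᵒᵖ F]
    [Module.Finite Aᵐᵒᵖ (Relations p)] [Module.Projective Aᵐᵒᵖ (Relations p)]
    (hp : Function.Surjective p) (hext : HasProjectiveDimensionLE (extLeft (rightModule f) 1) 1) :
    ∃ (n : ℕ) (x : Fin n → rightModule f) (h : Fin n → Dual A (rightModule f)),
      IsDualBasis x h := by
  have hι := Submodule.subtype_injective (LinearMap.ker (presentation p))
  have hex := LinearMap.exact_subtype_ker_map (presentation p)
  have hsurj := presentation_surjective hp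
  have := (hasProjectiveDimensionLE_one_iff (Submodule.subtype_injective _)
    (exact_range_subtype (exact_dualMap_extConnecting hι hex hsurj))
    (extConnecting_surjective hι hex hsurj)).1 hext
  exact exists_isDualBasis_of_projective_range hex hsurj

theorem isStratifyingIdeal_ker_mu [IsSemiprimaryRing A] (hinj : Function.Injective f)
    (hf : IsRingEpi f) {ι : Type*} [Fintype ι] {x : ι → rightModule f}
    {h : ι → Dual A (rightModule f)} (hxh : IsDualBasis x h) :
    IsStratifyingIdeal (RingHom.ker (mu f)) :=
  have := projective_ker_mu hinj hf hxh
  have hsq := ker_mu_mul_self hinj hf hxh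
  ⟨exists_isIdempotentElem_eq_span_of_mul_self _ hsq, isHomologicalEpi_quotient_mk _ hsq⟩

end Assembly

section ArtinAlgebra

theorem isNoetherianRing_op (k A : Type*) [CommRing k] [IsNoetherianRing k] [Ring A] [Algebra k A]
    [Module.Finite k A] : IsNoetherianRing Aᵐᵒᵖ :=
  isNoetherian_of_tower k (isNoetherian_of_isNoetherianRing_of_finite k Aᵐᵒᵖ)

theorem finite_rightModule {k : Type*} {A B : Type u} [CommRing k] [Ring A] [Ring B] [Algebra k A]
    [Algebra k B] [Module.Finite k B] (g : A →ₐ[k] B) :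
    Module.Finite Aᵐᵒᵖ (rightModule (g : A →+* B)) := by
  let _ : Module k (rightModule (g : A →+* B)) := inferInstanceAs (Module k B)
  have : Module.Finite k (rightModule (g : A →+* B)) := inferInstanceAs (Module.Finite k B)
  have : IsScalarTower k Aᵐᵒᵖ (rightModule (g : A →+* B)) := ⟨fun c a (b : B) => by
    change b * g (c • unop a) = c • (b * g (unop a))
    rw [map_smul, mul_smul_comm]⟩
  exact Module.Finite.of_restrictScalars_finite k Aᵐᵒᵖ _

end ArtinAlgebra

end RingEpi

end

theorem mainTheorem9_general {A B : Type u} [Ring A] [Ring B] (f : A →+* B)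
    (hinj : Function.Injective f) (hf : RingEpi.IsRingEpi f)
    [Module.FinitePresentation Aᵐᵒᵖ (RingEpi.rightModule f)]
    (hpd : HasProjectiveDimensionLE (RingEpi.rightModule f) 1)
    (htor : Limits.IsZero (RingEpi.Tor 1 (RingEpi.rightModule f) (RingEpi.leftModule f))) :
    RingEpi.IsHomologicalEpi (RingEpi.mu f) ∧
    HasProjectiveDimensionLE (RingEpi.leftModule (RingEpi.mu f)) 1 ∧
    (IsSemiprimaryRing A → HasProjectiveDimensionLE (RingEpi.extLeft (RingEpi.rightModule f) 1) 1 →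
      RingEpi.IsStratifyingIdeal (RingHom.ker (RingEpi.mu f))) := by
  obtain ⟨n, p, hp⟩ := Module.Finite.exists_fin' Aᵐᵒᵖ (RingEpi.rightModule f)
  have := RingEpi.finite_relations hp
  have := RingEpi.projective_relations hp hpd
  have hu := RingEpi.tensorMap_relationsSnd_bijective hf hp htor
  refine ⟨RingEpi.isHomologicalEpi_mu hinj hf hp hu,
    RingEpi.hasProjectiveDimensionLE_mu hinj hp hu, fun _ hext => ?_⟩
  obtain ⟨n, x, h, hxh⟩ := RingEpi.exists_isDualBasis_of_ext hp hext
  exact RingEpi.isStratifyingIdeal_ker_mu hinj hf hxh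

theorem mainTheorem9 {k : Type*} [CommRing k] [IsArtinianRing k]
    {A B : Type u} [Ring A] [Ring B] [Algebra k A] [Algebra k B]
    [Module.Finite k A] [Module.Finite k B]
    (lam : A →ₐ[k] B)
    (h_inj : Function.Injective lam)
    (h_epi : RingEpi.IsRingEpi (lam : A →+* B))
    (h_pd : HasProjectiveDimensionLE (RingEpi.rightModule (lam : A →+* B)) 1)
    (h_tor : Limits.IsZero
      (RingEpi.Tor 1 (RingEpi.rightModule (lam : A →+* B)) (RingEpi.leftModule (lam : A →+* B)))) :
    RingEpi.IsHomologicalEpi (RingEpi.mu (lam : A →+* B)) ∧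
    HasProjectiveDimensionLE (RingEpi.leftModule (RingEpi.mu (lam : A →+* B))) 1 ∧
    (HasProjectiveDimensionLE (RingEpi.extLeft (RingEpi.rightModule (lam : A →+* B)) 1) 1 →
      RingEpi.IsStratifyingIdeal (RingHom.ker (RingEpi.mu (lam : A →+* B)))) := by
  have : IsArtinianRing A := IsArtinianRing.of_finite k A
  have := RingEpi.isNoetherianRing_op k A
  have := RingEpi.finite_rightModule lam
  have := Module.finitePresentation_of_finite Aᵐᵒᵖ (RingEpi.rightModule (lam : A →+* B))
  obtain ⟨hmu, hpd, hker⟩ := mainTheorem9_general (lam : A →+* B) h_inj h_epi h_pd h_tor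
  exact ⟨hmu, hpd, hker inferInstance⟩
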